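/- Write $e(t)=\exp(2\pi i t)$; $n\sim Y$ means that $n$ runs through the integers of a subinterval of $(Y,2Y]$, whose endpoints may depend on the outer summation variables. Let $1/2<\gamma<1$, $0\le\Delta<1/2$, $\varepsilon>0$, and put $$\mathfrak b=16(1-\gamma)+16\Delta+112\varepsilon,$$ $$\mathfrak c=\min\Big\{\tfrac{16}{17}-\tfrac{16}{17}(1-\gamma)-\tfrac{32}{17}\Delta-\tfrac{224}{17}\varepsilon,\ \ 2-32(1-\gamma)-32\Delta-224\varepsilon\Big\}.$$ Let $X\ge1$, $H_1=X^{1-\gamma}$ and $0<H\le H_0=X^{1-\gamma+\Delta+7\varepsilon}$, let $0\le u\le1$ and $\alpha\in\mathbb R$, and let $M,K$ be real numbers with $MK\asymp X$ and $X^{\mathfrak b}\le M\le X^{\mathfrak c}$. Let $a_m$, $b_k$ be complex numbers with $|a_m|\ll1$ and $|b_k|\ll1$. Then $$\min\Big\{1,\frac{H_1}{H}\Big\}\sum_{h\sim H}\Big|\sum_{m\sim M}\sum_{k\sim K}a_mb_k\,e\big(m^3k^3\alpha+h(mk+u)^\gamma\big)\Big|\ll X^{1-\Delta-7\varepsilon},$$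 where the implied constant depends at most on $\gamma,\Delta,\varepsilon$ and on the constants implied in $MK\asymp X$, $|a_m|\ll1$ and $|b_k|\ll1$; in particular it is uniform in $X,M,K,H,\alpha,u$, in the coefficients, and in the choice of the subintervals. -/

import Mathlib

namespace TypeII

/-- The additive character `e(t) = exp(2πit)`. -/
noncomputable def e (t : ℝ) : ℂ := Complex.exp (2 * Real.pi * Complex.I * t)

/-- The convention `n ∼ Y`: the finite set `S` consists of exactly the integers contained in
some subinterval of `(Y, 2Y]` (possibly empty, with or without its endpoints). -/
def RunsOver (Y : ℝ) (S : Finset ℕ) : Prop :=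
  ∃ I : Set ℝ, I.OrdConnected ∧ I ⊆ Set.Ioc Y (2 * Y) ∧ ∀ n : ℕ, n ∈ S ↔ (n : ℝ) ∈ I

/-- The exponent `𝔟 = 16(1-γ) + 16Δ + 112ε`. -/
noncomputable def bExp (γ Δ ε : ℝ) : ℝ := 16 * (1 - γ) + 16 * Δ + 112 * ε

/-- The exponent
`𝔠 = min {16/17 - (16/17)(1-γ) - (32/17)Δ - (224/17)ε, 2 - 32(1-γ) - 32Δ - 224ε}`. -/
noncomputable def cExp (γ Δ ε : ℝ) : ℝ :=
  min (16 / 17 - 16 / 17 * (1 - γ) - 32 / 17 * Δ - 224 / 17 * ε)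
    (2 - 32 * (1 - γ) - 32 * Δ - 224 * ε)

/-- `H₀ = X^{1-γ+Δ+7ε}`, the upper limit for `H`. -/
noncomputable def H₀ (γ Δ ε X : ℝ) : ℝ := X ^ (1 - γ + Δ + 7 * ε)

/-- `H₁ = X^{1-γ}`. -/
noncomputable def H₁ (γ X : ℝ) : ℝ := X ^ (1 - γ)

/-- The Type II sum
`min{1, H₁/H} ∑_h |∑_m ∑_k a_m b_k e(m³k³α + h(mk+u)^γ)|`,
where `h` runs over `hs`, `m` over `ms h` and `k` over `ks h m`
(the inner ranges may depend on the outer summation variables). -/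
noncomputable def SII (γ X H α u : ℝ) (a b : ℕ → ℂ)
    (hs : Finset ℕ) (ms : ℕ → Finset ℕ) (ks : ℕ → ℕ → Finset ℕ) : ℝ :=
  min 1 (H₁ γ X / H) *
    ∑ h ∈ hs, ‖∑ m ∈ ms h, ∑ k ∈ ks h m,
      a m * b k * e ((m : ℝ) ^ 3 * (k : ℝ) ^ 3 * α + (h : ℝ) * ((m : ℝ) * (k : ℝ) + u) ^ γ)‖

end TypeII

namespace TypeII

/-! The weight `min 1 (H₁ / H)` times the at most 2H frequencies h costs only 2X^{1-γ}, so no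
cancellation in h is needed. With E = 1-γ+Δ+7ε and Z = X^E it suffices to bound each double sum over
m and k by O(X/Z); this is `bilinear_saving`.

For fixed h, one variable x, of size N, plays the smooth role and the other, y, of size Y, the rough
one. Cauchy–Schwarz in x discards the coefficient of x, and opening the square leaves the
correlations ∑_x e(phase(x,y) - phase(x,z)). Their α-part is a cubic polynomial in x, hence
invisible to fourth differences, which gives uniformity in α. The remaining part has a fourth
x-derivative of constant sign and of size F·(|z-y|/Y)·N^{-4}, where F = h(NY)^γ. Two van der Corput
steps and the second derivative test (`fourth_difference_bound`) yield `pair_bound`: the correlation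
is O(N Z^{-2} (Y/|z-y|)^{1/2}) as soon as Z^16 ≤ N, F Z^28 ≤ N^4 and Z^20 ≤ F. Since ∑ d^{-1/2} over
d ≤ 2Y is O(√Y), the off-diagonal terms save Z² in the square; the diagonal saves Y, so Y must be at
least about Z².

If F Z^28 ≤ M^4, then m is the smooth variable; otherwise M is short and MK ≍ X makes K long enough.
When k is smooth (`bilinear_smooth_inner`), the ranges attached to two values of m meet in an
interval and cause no trouble. When m is smooth (`bilinear_smooth_outer`), the range of the rough k
varies with m, and a decomposition into dyadic blocks (`maximal_bound`) removes the dependence.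

The exponents enter as follows: 𝔟 = 16E gives Z^16 ≤ M, the first entry of 𝔠 keeps K above Z² with
room for a logarithm, and the second entry, compared with 𝔟, forces E ≤ 1/24. -/

lemma e_add (s t : ℝ) : e (s + t) = e s * e t := by
  simp only [e, ← Complex.exp_add]; congr 1; push_cast; ring

lemma norm_e (t : ℝ) : ‖e t‖ = 1 := by
  have : (2 * Real.pi * Complex.I * t : ℂ) = ((2 * Real.pi * t : ℝ) : ℂ) * Complex.I := by
    push_cast; ring
  rw [e, this, Complex.norm_exp_ofReal_mul_I]

lemma e_intCast (n : ℤ) : e n = 1 := by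
  rw [e, Complex.exp_eq_one_iff]; exact ⟨n, by push_cast; ring⟩

lemma conj_e (t : ℝ) : (starRingEnd ℂ) (e t) = e (-t) := by
  rw [e, e, ← Complex.exp_conj]; congr 1; simp [map_ofNat]

lemma e_mul_conj (s t : ℝ) : e s * (starRingEnd ℂ) (e t) = e (s - t) := by
  rw [conj_e, ← e_add, sub_eq_add_neg]

/-! ### The Kusmin–Landau inequality -/

/-- The cotangent of `πx`. -/
noncomputable def cotPi (x : ℝ) : ℝ := Real.cos (Real.pi * x) / Real.sin (Real.pi * x)

/-- The inverse of `e(x) - 1`. -/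
noncomputable def invSub (x : ℝ) : ℂ := -1 / 2 - Complex.I / 2 * (cotPi x : ℂ)

lemma invSub_mul {x : ℝ} (hx : Real.sin (Real.pi * x) ≠ 0) : invSub x * (e x - 1) = 1 := by
  have h1 : e x = (Real.cos (Real.pi * x) + Real.sin (Real.pi * x) * Complex.I : ℂ) ^ 2 := by
    rw [Complex.ofReal_cos, Complex.ofReal_sin, ← Complex.exp_mul_I, ← Complex.exp_nat_mul, e]
    congr 1; push_cast; ring
  have h2 : (Real.sin (Real.pi * x) : ℂ) ≠ 0 := by exact_mod_cast hx
  have h3 : (Real.cos (Real.pi * x) : ℂ) ^ 2 = 1 - (Real.sin (Real.pi * x) : ℂ) ^ 2 := by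
    have := Real.cos_sq' (Real.pi * x); exact_mod_cast this
  rw [h1, invSub, cotPi, Complex.ofReal_div]
  generalize (Real.sin (Real.pi * x) : ℂ) = s at *
  generalize (Real.cos (Real.pi * x) : ℂ) = c at *
  field_simp
  have h4 : Complex.I ^ 2 = -1 := Complex.I_sq
  have h5 : Complex.I ^ 3 = -Complex.I := by rw [pow_succ, h4]; ring
  ring_nf
  have h6 : c ^ 3 = c * (1 - s ^ 2) := by rw [← h3]; ring
  simp only [h3, h4, h5, h6]
  ring

lemma two_mul_le_sin_pi {θ x : ℝ} (h0 : 0 < θ) (h1 : θ ≤ x) (h2 : x ≤ 1 - θ) :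
    2 * θ ≤ Real.sin (Real.pi * x) := by
  have hpi := Real.pi_pos
  rcases le_total x (1 / 2) with h | h
  · have := Real.mul_le_sin (x := Real.pi * x) (by nlinarith) (by nlinarith)
    have h3 : 2 / Real.pi * (Real.pi * x) = 2 * x := by field_simp
    linarith
  · have := Real.mul_le_sin (x := Real.pi * (1 - x)) (by nlinarith) (by nlinarith)
    have h3 : 2 / Real.pi * (Real.pi * (1 - x)) = 2 * (1 - x) := by field_simp
    have h4 : Real.sin (Real.pi * (1 - x)) = Real.sin (Real.pi * x) := by
      rw [show Real.pi * (1 - x) = Real.pi - Real.pi * x by ring, Real.sin_pi_sub]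
    linarith

lemma abs_cotPi_le {θ x : ℝ} (h0 : 0 < θ) (h1 : θ ≤ x) (h2 : x ≤ 1 - θ) :
    |cotPi x| ≤ 1 / (2 * θ) := by
  have h := two_mul_le_sin_pi h0 h1 h2
  rw [cotPi, abs_div, abs_of_pos (a := Real.sin _) (by linarith)]
  exact div_le_div₀ zero_le_one (Real.abs_cos_le_one _) (by linarith) h

lemma cotPi_anti {θ x y : ℝ} (h0 : 0 < θ) (h1 : θ ≤ x) (hxy : x ≤ y) (h2 : y ≤ 1 - θ) :
    cotPi y ≤ cotPi x := by
  have hx := two_mul_le_sin_pi h0 h1 (hxy.trans h2)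
  have hy := two_mul_le_sin_pi h0 (h1.trans hxy) h2
  have hpi := Real.pi_pos
  rw [cotPi, cotPi, div_le_div_iff₀ (by linarith) (by linarith)]
  have := Real.sin_nonneg_of_nonneg_of_le_pi (x := Real.pi * y - Real.pi * x)
    (by nlinarith) (by nlinarith)
  rw [Real.sin_sub] at this
  linarith

lemma norm_invSub_le {θ x : ℝ} (h0 : 0 < θ) (h1 : θ ≤ x) (h2 : x ≤ 1 - θ) :
    ‖invSub x‖ ≤ 1 / (2 * θ) := by
  have h := abs_cotPi_le h0 h1 h2
  have hθ : θ ≤ 1 / 2 := by linarith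
  have h3 : ‖invSub x‖ ≤ 1 / 2 + 1 / 2 * |cotPi x| := by
    refine (norm_sub_le _ _).trans ?_
    simp
  have h4 : (1 : ℝ) / 2 ≤ 1 / 2 * (1 / (2 * θ)) := by
    rw [le_mul_iff_one_le_right (by norm_num), le_div_iff₀ (by linarith)]; linarith
  linarith

lemma norm_invSub_sub_le {θ x y : ℝ} (h0 : 0 < θ) (h1 : θ ≤ x) (hxy : x ≤ y) (h2 : y ≤ 1 - θ) :
    ‖invSub x - invSub y‖ ≤ 1 / 2 * (cotPi x - cotPi y) := by
  have h := cotPi_anti h0 h1 hxy h2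
  have : invSub x - invSub y = Complex.I / 2 * ((cotPi y - cotPi x : ℝ) : ℂ) := by
    rw [invSub, invSub]; push_cast; ring
  rw [this, norm_mul, Complex.norm_real, Real.norm_eq_abs, abs_sub_comm, abs_of_nonneg (by linarith)]
  simp

/-- Each term is `invSub (D n)` times the increment of e(φ), with D the first difference of φ.
Summation by parts moves the differences onto `invSub ∘ D`; as the cotangent decreases on (0,1) and
D is monotone, their norms telescope, and everything is controlled by |cot| at the two ends. -/
theorem kusmin_landau_unit (φ : ℕ → ℝ) (a b : ℕ) {θ : ℝ} (hθ : 0 < θ)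
    (h1 : ∀ n, a ≤ n → n < b → θ ≤ φ (n + 1) - φ n)
    (h2 : ∀ n, a ≤ n → n < b → φ (n + 1) - φ n ≤ 1 - θ)
    (hm : ∀ n, a ≤ n → n + 1 < b → φ (n + 1) - φ n ≤ φ (n + 2) - φ (n + 1)) :
    ‖∑ n ∈ Finset.Ico a b, e (φ n)‖ ≤ 2 / θ := by
  rcases le_or_gt b a with hab | hab
  · rw [Finset.Ico_eq_empty_of_le hab]; simp; positivity
  set D : ℕ → ℝ := fun n => φ (n + 1) - φ n with hD
  have hw : ∀ n, a ≤ n → n < b → e (φ n) = invSub (D n) * (e (φ (n + 1)) - e (φ n)) := by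
    intro n hn hnb
    have hs : Real.sin (Real.pi * D n) ≠ 0 := by
      have := two_mul_le_sin_pi hθ (h1 n hn hnb) (h2 n hn hnb); simp only [hD]; linarith
    have h3 : e (φ (n + 1)) = e (D n) * e (φ n) := by rw [← e_add]; simp [hD]
    rw [h3]
    calc e (φ n) = (invSub (D n) * (e (D n) - 1)) * e (φ n) := by rw [invSub_mul hs, one_mul]
      _ = _ := by ring
  -- The boundary term of the summation by parts is kept on the left, so that each step of the
  -- induction adds exactly one difference of `invSub`.
  have key : ∀ j, a + j < b →
      ‖∑ n ∈ Finset.Ico a (a + j + 1), e (φ n) - invSub (D (a + j)) * e (φ (a + j + 1))‖ ≤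
        ‖invSub (D a)‖ + 1 / 2 * (cotPi (D a) - cotPi (D (a + j))) := by
    intro j
    induction j with
    | zero =>
      intro hj
      have h := hw a le_rfl hab
      simp only [add_zero, Nat.Ico_succ_singleton, Finset.sum_singleton, sub_self, mul_zero]
      have h4 : e (φ a) - invSub (D a) * e (φ (a + 1)) = - (invSub (D a) * e (φ a)) := by
        linear_combination h
      rw [h4, norm_neg, norm_mul, norm_e, mul_one]
    | succ j ih =>
      intro hj
      have ih := ih (by omega)
      have h := hw (a + j + 1) (by omega) (by omega)
      rw [Finset.sum_Ico_succ_top (by omega)]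
      have h4 : ∑ n ∈ Finset.Ico a (a + (j + 1)), e (φ n) + e (φ (a + (j + 1))) -
          invSub (D (a + (j + 1))) * e (φ (a + (j + 1) + 1)) =
          (∑ n ∈ Finset.Ico a (a + j + 1), e (φ n) - invSub (D (a + j)) * e (φ (a + j + 1))) +
          (invSub (D (a + j)) - invSub (D (a + j + 1))) * e (φ (a + j + 1)) := by
        rw [← add_assoc]; linear_combination h
      rw [h4]
      refine (norm_add_le _ _).trans ?_
      rw [norm_mul, norm_e, mul_one, ← add_assoc]
      have h5 := norm_invSub_sub_le hθ (h1 (a + j) (by omega) (by omega))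
        (hm (a + j) (by omega) (by omega)) (h2 (a + j + 1) (by omega) (by omega))
      simp only [hD] at *
      linarith
  obtain ⟨j, rfl⟩ : ∃ j, b = a + j + 1 := ⟨b - a - 1, by omega⟩
  have hk := key j (by omega)
  have e1 := norm_invSub_le hθ (h1 a (by omega) (by omega)) (h2 a (by omega) (by omega))
  have e2 := norm_invSub_le hθ (h1 (a + j) (by omega) (by omega)) (h2 (a + j) (by omega) (by omega))
  have e3 := abs_le.1 (abs_cotPi_le hθ (h1 a (by omega) (by omega)) (h2 a (by omega) (by omega)))
  have e4 := abs_le.1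
    (abs_cotPi_le hθ (h1 (a + j) (by omega) (by omega)) (h2 (a + j) (by omega) (by omega)))
  have e5 := norm_sub_norm_le (∑ n ∈ Finset.Ico a (a + j + 1), e (φ n))
    (invSub (D (a + j)) * e (φ (a + j + 1)))
  rw [norm_mul, norm_e, mul_one] at e5
  have e6 : 2 / θ = 4 * (1 / (2 * θ)) := by field_simp; norm_num
  have e7 : 0 < 1 / (2 * θ) := by positivity
  simp only [hD] at *
  linarith

theorem kusmin_landau (φ : ℕ → ℝ) (a b : ℕ) (ν : ℤ) {θ : ℝ} (hθ : 0 < θ)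
    (h1 : ∀ n, a ≤ n → n < b → ν + θ ≤ φ (n + 1) - φ n)
    (h2 : ∀ n, a ≤ n → n < b → φ (n + 1) - φ n ≤ ν + 1 - θ)
    (hm : ∀ n, a ≤ n → n + 1 < b → φ (n + 1) - φ n ≤ φ (n + 2) - φ (n + 1)) :
    ‖∑ n ∈ Finset.Ico a b, e (φ n)‖ ≤ 2 / θ := by
  have := kusmin_landau_unit (fun n => φ n - ν * n) a b hθ
    (fun n hn hb => by have := h1 n hn hb; push_cast; linarith)
    (fun n hn hb => by have := h2 n hn hb; push_cast; linarith)
    (fun n hn hb => by have := hm n hn hb; push_cast; linarith)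
  convert this using 2
  refine Finset.sum_congr rfl fun n _ => ?_
  rw [show φ n - ν * n = φ n + ((-(ν * n) : ℤ) : ℝ) by push_cast; ring, e_add, e_intCast, mul_one]

/-! ### The second derivative test -/

lemma exists_eq_Ico_of_convex (F : Finset ℕ)
    (hF : ∀ x ∈ F, ∀ z ∈ F, ∀ y, x ≤ y → y ≤ z → y ∈ F) : ∃ a b, F = Finset.Ico a b := by
  rcases F.eq_empty_or_nonempty with rfl | hne
  · exact ⟨0, 0, by simp⟩
  · refine ⟨F.min' hne, F.max' hne + 1, ?_⟩
    ext y
    rw [Finset.mem_Ico, Nat.lt_succ_iff]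
    exact ⟨fun h => ⟨F.min'_le y h, F.le_max' y h⟩,
      fun h => hF _ (F.min'_mem hne) _ (F.max'_mem hne) y h.1 h.2⟩

lemma exists_filter_eq_Ico {D : ℕ → ℝ} {a b : ℕ}
    (hD : ∀ m n, a ≤ m → m ≤ n → n < b → D m ≤ D n) (s t : ℝ) :
    ∃ p q, (Finset.Ico a b).filter (fun n => s ≤ D n ∧ D n ≤ t) = Finset.Ico p q := by
  refine exists_eq_Ico_of_convex _ fun x hx z hz y hxy hyz => ?_
  simp only [Finset.mem_filter, Finset.mem_Ico] at *
  have := hD x y (by omega) hxy (by omega)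
  have := hD y z (by omega) hyz (by omega)
  exact ⟨⟨by omega, by omega⟩, by linarith, by linarith⟩

lemma increment_ge {D : ℕ → ℝ} {a b : ℕ} {l : ℝ}
    (h : ∀ n, a ≤ n → n + 1 < b → l ≤ D (n + 1) - D n) {m : ℕ} (hm : a ≤ m) (j : ℕ)
    (hj : m + j < b) : l * j ≤ D (m + j) - D m := by
  induction j with
  | zero => simp
  | succ j ih =>
    have := ih (by omega)
    have := h (m + j) (by omega) (by omega)
    push_cast
    rw [← add_assoc]
    linarith

lemma increment_le {D : ℕ → ℝ} {a b : ℕ} {l : ℝ}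
    (h : ∀ n, a ≤ n → n + 1 < b → D (n + 1) - D n ≤ l) {m : ℕ} (hm : a ≤ m) (j : ℕ)
    (hj : m + j < b) : D (m + j) - D m ≤ l * j := by
  have := increment_ge (D := fun n => - D n) (l := -l) (a := a) (b := b)
    (fun n hn hb => by have := h n hn hb; linarith) hm j hj
  linarith

lemma card_filter_le {D : ℕ → ℝ} {a b : ℕ} {l : ℝ} (hl : 0 < l)
    (h : ∀ n, a ≤ n → n + 1 < b → l ≤ D (n + 1) - D n) (s t : ℝ) (hst : s ≤ t) :
    (((Finset.Ico a b).filter (fun n => s ≤ D n ∧ D n ≤ t)).card : ℝ) ≤ (t - s) / l + 1 := by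
  have hD : ∀ m n, a ≤ m → m ≤ n → n < b → D m ≤ D n := by
    intro m n hm hmn hn
    obtain ⟨j, rfl⟩ := Nat.exists_eq_add_of_le hmn
    have := increment_ge h hm j hn
    have : 0 ≤ l * j := by positivity
    linarith
  obtain ⟨p, q, hpq⟩ := exists_filter_eq_Ico hD s t
  rcases le_or_gt q p with hle | hlt
  · rw [hpq, Finset.Ico_eq_empty_of_le hle]
    have := div_nonneg (sub_nonneg.2 hst) hl.le
    rw [Finset.card_empty, Nat.cast_zero]; linarith
  · obtain ⟨j, rfl⟩ : ∃ j, q = p + j + 1 := ⟨q - p - 1, by omega⟩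
    have h1 : p ∈ Finset.Ico p (p + j + 1) := by simp
    have h2 : p + j ∈ Finset.Ico p (p + j + 1) := by simp
    rw [← hpq] at h1 h2
    simp only [Finset.mem_filter, Finset.mem_Ico] at h1 h2
    have h3 := increment_ge h h1.1.1 j h2.1.2
    rw [hpq, Nat.card_Ico, show p + j + 1 - p = j + 1 by omega]
    have : (j : ℝ) ≤ (t - s) / l := by rw [le_div_iff₀ hl]; linarith
    push_cast; linarith

lemma norm_sum_e_le_card (φ : ℕ → ℝ) (S : Finset ℕ) : ‖∑ n ∈ S, e (φ n)‖ ≤ S.card := by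
  refine (norm_sum_le _ _).trans ?_
  simp [norm_e]

/-- First differences increase by at least l, so at most θ/l + 1 of them lie within θ of either end
of [ν, ν+1]; these terms are counted trivially, and Kusmin–Landau handles the rest. The choice θ =
√l balances the two contributions. -/
lemma second_difference_fiber (φ : ℕ → ℝ) (a b : ℕ) {l θ : ℝ} (hl : 0 < l) (hθ : 0 < θ)
    (h1 : ∀ n, a ≤ n → n + 1 < b → l ≤ (φ (n + 2) - φ (n + 1)) - (φ (n + 1) - φ n)) (ν : ℤ) :
    ‖∑ n ∈ (Finset.Ico a b).filter (fun n => ⌊φ (n + 1) - φ n⌋ = ν), e (φ n)‖ ≤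
      2 * θ / l + 2 + 2 / θ := by
  set D : ℕ → ℝ := fun n => φ (n + 1) - φ n with hDdef
  have hD : ∀ m n, a ≤ m → m ≤ n → n < b → D m ≤ D n := by
    intro m n hm hmn hn
    obtain ⟨j, rfl⟩ := Nat.exists_eq_add_of_le hmn
    have := increment_ge (D := D) h1 hm j hn
    have : 0 ≤ l * j := by positivity
    linarith
  set S := (Finset.Ico a b).filter (fun n => ⌊D n⌋ = ν) with hS
  set S2 := (Finset.Ico a b).filter (fun n => (ν : ℝ) + θ ≤ D n ∧ D n ≤ ν + 1 - θ) with hS2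
  set S1 := (Finset.Ico a b).filter (fun n => (ν : ℝ) ≤ D n ∧ D n ≤ ν + θ) with hS1
  set S3 := (Finset.Ico a b).filter (fun n => (ν : ℝ) + 1 - θ ≤ D n ∧ D n ≤ ν + 1) with hS3
  have hsub : S2 ⊆ S := by
    intro n hn
    simp only [hS2, hS, Finset.mem_filter] at *
    refine ⟨hn.1, Int.floor_eq_iff.2 ⟨by linarith, by linarith⟩⟩
  have hrest : S \ S2 ⊆ S1 ∪ S3 := by
    intro n hn
    simp only [hS2, hS, hS1, hS3, Finset.mem_sdiff, Finset.mem_union, Finset.mem_filter] at *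
    obtain ⟨⟨hn1, hn2⟩, hn3⟩ := hn
    obtain ⟨h4, h5⟩ := Int.floor_eq_iff.1 hn2
    by_cases h6 : D n ≤ ν + θ
    · exact Or.inl ⟨hn1, h4, h6⟩
    · refine Or.inr ⟨hn1, ?_, h5.le⟩
      by_contra h7
      exact hn3 ⟨hn1, by linarith, by linarith⟩
  have hKL : ‖∑ n ∈ S2, e (φ n)‖ ≤ 2 / θ := by
    obtain ⟨p, q, hpq⟩ := exists_filter_eq_Ico hD (ν + θ) (ν + 1 - θ)
    have hmem : ∀ n, p ≤ n → n < q → (a ≤ n ∧ n < b) ∧ (ν : ℝ) + θ ≤ D n ∧ D n ≤ ν + 1 - θ := by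
      intro n hn1 hn2
      have : n ∈ Finset.Ico p q := by simp; omega
      rw [← hpq] at this
      simpa only [Finset.mem_filter, Finset.mem_Ico] using this
    rw [hS2, hpq]
    refine kusmin_landau φ p q ν hθ (fun n h1 h2 => (hmem n h1 h2).2.1)
      (fun n h1 h2 => (hmem n h1 h2).2.2) (fun n hn1 hn2 => ?_)
    have h3 := hmem n hn1 (by omega)
    have h4 := hmem (n + 1) (by omega) hn2
    have := h1 n h3.1.1 h4.1.2
    linarith
  have hc1 := card_filter_le hl (D := D) h1 ν (ν + θ) (by linarith)
  have hc3 := card_filter_le hl (D := D) h1 (ν + 1 - θ) (ν + 1) (by linarith)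
  rw [← Finset.sum_sdiff hsub]
  have hcard : ((S \ S2).card : ℝ) ≤ S1.card + S3.card := by
    exact_mod_cast (Finset.card_le_card hrest).trans (Finset.card_union_le _ _)
  have h7 := norm_sum_e_le_card φ (S \ S2)
  have h8 : (ν + θ - ν : ℝ) / l = θ / l := by ring
  have h9 : (ν + 1 - (ν + 1 - θ) : ℝ) / l = θ / l := by ring
  have h10 : 2 * θ / l = θ / l + θ / l := by ring
  refine (norm_add_le _ _).trans ?_
  rw [h8] at hc1
  rw [h9] at hc3
  linarith

/-- Van der Corput's second derivative test, for second differences in `[l, l']`. -/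
theorem second_difference_test (φ : ℕ → ℝ) (a b : ℕ) {l l' : ℝ} (hl : 0 < l) (hl' : l ≤ l')
    (h1 : ∀ n, a ≤ n → n + 1 < b → l ≤ (φ (n + 2) - φ (n + 1)) - (φ (n + 1) - φ n))
    (h2 : ∀ n, a ≤ n → n + 1 < b → (φ (n + 2) - φ (n + 1)) - (φ (n + 1) - φ n) ≤ l') :
    ‖∑ n ∈ Finset.Ico a b, e (φ n)‖ ≤ (l' * (b - a : ℕ) + 2) * (5 / √l) := by
  have hsq : 0 < √l := Real.sqrt_pos.2 hl
  have hss : √l * √l = l := Real.mul_self_sqrt hl.le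
  rcases le_or_gt b a with hab | hab
  · rw [Finset.Ico_eq_empty_of_le hab, Nat.sub_eq_zero_of_le hab]; simp; positivity
  -- For l > 1/4 the claim is weaker than the trivial bound; otherwise 2 ≤ 1/√l absorbs the constant
  -- from the fibers.
  rcases le_or_gt l (1 / 4) with hl4 | hl4
  swap
  · have h3 : 1 / 2 ≤ √l := by
      rw [show (1 : ℝ) / 2 = √(1 / 4) by rw [show (1 : ℝ) / 4 = (1 / 2) ^ 2 by norm_num]; simp]
      exact Real.sqrt_le_sqrt hl4.le
    refine (norm_sum_e_le_card φ _).trans ?_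
    rw [Nat.card_Ico]
    have h4 : (0 : ℝ) ≤ ((b - a : ℕ) : ℝ) := by positivity
    have h5 : (1 : ℝ) ≤ l * (5 / √l) := by
      rw [mul_div_assoc', le_div_iff₀ hsq]; nlinarith
    calc ((b - a : ℕ) : ℝ) ≤ (l * (5 / √l)) * (b - a : ℕ) := le_mul_of_one_le_left h4 h5
      _ = (l * (b - a : ℕ)) * (5 / √l) := by ring
      _ ≤ _ := by gcongr; nlinarith
  have hl2 : √l ≤ 1 / 2 := by
    rw [show (1 : ℝ) / 2 = √(1 / 4) by rw [show (1 : ℝ) / 4 = (1 / 2) ^ 2 by norm_num]; simp]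
    exact Real.sqrt_le_sqrt hl4
  set D : ℕ → ℝ := fun n => φ (n + 1) - φ n with hDdef
  obtain ⟨j, rfl⟩ : ∃ j, b = a + j + 1 := ⟨b - a - 1, by omega⟩
  set T := Finset.Icc ⌊D a⌋ ⌊D (a + j)⌋ with hT
  have hmaps : ∀ n ∈ Finset.Ico a (a + j + 1), ⌊D n⌋ ∈ T := by
    intro n hn
    rw [Finset.mem_Ico] at hn
    obtain ⟨i, rfl⟩ := Nat.exists_eq_add_of_le hn.1
    have h3 := increment_ge (D := D) h1 le_rfl i hn.2
    have h4 := increment_ge (D := D) h1 (m := a + i) (by omega) (j - i) (by omega)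
    rw [show a + i + (j - i) = a + j by omega] at h4
    have h5 : 0 ≤ l * (i : ℝ) := by positivity
    have h6 : 0 ≤ l * ((j - i : ℕ) : ℝ) := by positivity
    rw [hT, Finset.mem_Icc]
    exact ⟨Int.floor_le_floor (by linarith), Int.floor_le_floor (by linarith)⟩
  have hTcard : (T.card : ℝ) ≤ l' * j + 2 := by
    have h3 := increment_le (D := D) h2 le_rfl j (by omega)
    have h3' := increment_ge (D := D) h1 le_rfl j (by omega)
    have h5 : 0 ≤ l * (j : ℝ) := by positivity
    have h4 : ⌊D a⌋ ≤ ⌊D (a + j)⌋ := Int.floor_le_floor (by linarith)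
    rw [hT, Int.card_Icc]
    have : (((⌊D (a + j)⌋ + 1 - ⌊D a⌋).toNat : ℤ) : ℝ) = ⌊D (a + j)⌋ + 1 - ⌊D a⌋ := by
      rw [Int.toNat_of_nonneg (by omega)]; push_cast; ring
    rw [← Int.cast_natCast, this]
    have := Int.floor_le (D (a + j))
    have := Int.lt_floor_add_one (D a)
    linarith
  rw [← Finset.sum_fiberwise_of_maps_to hmaps]
  have hfib : ∀ ν ∈ T, ‖∑ n ∈ (Finset.Ico a (a + j + 1)).filter (fun n => ⌊D n⌋ = ν), e (φ n)‖ ≤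
      5 / √l := by
    intro ν _
    refine (second_difference_fiber φ a _ hl hsq h1 ν).trans ?_
    have h3 : 2 * √l / l = 2 / √l := by
      rw [div_eq_div_iff hl.ne' hsq.ne', mul_assoc, hss]
    have h4 : 2 ≤ 1 / √l := by rw [le_div_iff₀ hsq]; linarith
    have h5 : 5 / √l = 2 / √l + 1 / √l + 2 / √l := by ring
    rw [h3, h5]; linarith
  refine (norm_sum_le _ _).trans ((Finset.sum_le_sum hfib).trans ?_)
  rw [Finset.sum_const, nsmul_eq_mul]
  have hl0 : 0 < l' := hl.trans_le hl'
  gcongr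
  refine hTcard.trans ?_
  rw [show a + j + 1 - a = j + 1 by omega]
  push_cast; nlinarith

/-! ### Van der Corput's inequality -/

/-- Row sum of a symmetric Toeplitz matrix: each nonzero distance occurs at most twice. The distance
is written `max - min` because subtraction in ℕ truncates. -/
lemma sum_dist_le (c : ℕ → ℝ) (hc : ∀ r, 0 ≤ c r) (Q q : ℕ) (hq : q < Q) :
    ∑ p ∈ Finset.range Q, c (max q p - min q p) ≤ c 0 + 2 * ∑ r ∈ Finset.Ico 1 Q, c r := by
  have h1 : Finset.range Q = Finset.range q ∪ ({q} ∪ Finset.Ico (q + 1) Q) := by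
    ext x; simp only [Finset.mem_union, Finset.mem_range, Finset.mem_singleton, Finset.mem_Ico]
    omega
  have h2 : ∑ p ∈ Finset.range q, c (max q p - min q p) ≤ ∑ r ∈ Finset.Ico 1 Q, c r := by
    have : ∑ p ∈ Finset.range q, c (max q p - min q p) = ∑ r ∈ Finset.Ico 1 (q + 1), c r := by
      refine Finset.sum_bij' (fun p _ => q - p) (fun r _ => q - r) ?_ ?_ ?_ ?_ ?_
      · intro p hp; simp at *; omega
      · intro p hp; simp at *; omega
      · intro p hp; simp at *; omega
      · intro p hp; simp at *; omega
      · intro p hp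
        rw [Finset.mem_range] at hp
        rw [max_eq_left hp.le, min_eq_right hp.le]
    rw [this]
    exact Finset.sum_le_sum_of_subset_of_nonneg (Finset.Ico_subset_Ico le_rfl hq)
      fun r _ _ => hc r
  have h3 : ∑ p ∈ Finset.Ico (q + 1) Q, c (max q p - min q p) ≤ ∑ r ∈ Finset.Ico 1 Q, c r := by
    have : ∑ p ∈ Finset.Ico (q + 1) Q, c (max q p - min q p) =
        ∑ r ∈ Finset.Ico 1 (Q - q), c r := by
      refine Finset.sum_bij' (fun p _ => p - q) (fun r _ => r + q) ?_ ?_ ?_ ?_ ?_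
      · intro p hp; simp at *; omega
      · intro p hp; simp at *; omega
      · intro p hp; simp at *; omega
      · intro p hp; simp at *
      · intro p hp
        rw [Finset.mem_Ico] at hp
        rw [max_eq_right (by omega), min_eq_left (by omega)]
    rw [this]
    exact Finset.sum_le_sum_of_subset_of_nonneg (Finset.Ico_subset_Ico le_rfl (by omega))
      fun r _ _ => hc r
  rw [h1, Finset.sum_union, Finset.sum_union, Finset.sum_singleton, max_self, min_self, Nat.sub_self]
  · linarith
  · rw [Finset.disjoint_left]; intro x; simp; omega
  · rw [Finset.disjoint_left]; intro x; simp; omega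

lemma norm_sum_sq_expand {ι : Type*} (T : Finset ι) (f : ι → ℂ) :
    ((‖∑ i ∈ T, f i‖ ^ 2 : ℝ) : ℂ) = ∑ i ∈ T, ∑ j ∈ T, f i * (starRingEnd ℂ) (f j) := by
  rw [Complex.ofReal_pow, ← Complex.mul_conj', map_sum, Finset.sum_mul_sum]

lemma norm_sum_sq_le_card {ι : Type*} (T : Finset ι) (f : ι → ℂ) :
    ‖∑ i ∈ T, f i‖ ^ 2 ≤ T.card * ∑ i ∈ T, ‖f i‖ ^ 2 :=
  (pow_le_pow_left₀ (norm_nonneg _) (norm_sum_le _ _) 2).trans sq_sum_le_card_mul_sum_sq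

lemma sum_norm_sum_sq_le {ι κ : Type*} (U : Finset κ) (T : Finset ι) (f : κ → ι → ℂ) :
    ∑ x ∈ U, ‖∑ i ∈ T, f x i‖ ^ 2 ≤
      ∑ i ∈ T, ∑ j ∈ T, ‖∑ x ∈ U, f x i * (starRingEnd ℂ) (f x j)‖ := by
  have h : ((∑ x ∈ U, ‖∑ i ∈ T, f x i‖ ^ 2 : ℝ) : ℂ) =
      ∑ i ∈ T, ∑ j ∈ T, ∑ x ∈ U, f x i * (starRingEnd ℂ) (f x j) := by
    rw [Complex.ofReal_sum, Finset.sum_congr rfl fun x _ => norm_sum_sq_expand T (f x),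
      Finset.sum_comm]
    exact Finset.sum_congr rfl fun i _ => Finset.sum_comm
  have h2 : (∑ x ∈ U, ‖∑ i ∈ T, f x i‖ ^ 2 : ℝ) =
      ‖((∑ x ∈ U, ‖∑ i ∈ T, f x i‖ ^ 2 : ℝ) : ℂ)‖ := by
    rw [Complex.norm_real, Real.norm_eq_abs, abs_of_nonneg (by positivity)]
  rw [h2, h]
  exact (norm_sum_le _ _).trans (Finset.sum_le_sum fun i _ => norm_sum_le _ _)

/-- The correlation sum of `z` at shift `r`. -/
noncomputable def corr (z : ℕ → ℂ) (a b r : ℕ) : ℂ :=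
  ∑ n ∈ Finset.Ico a (b - r), z (n + r) * (starRingEnd ℂ) (z n)

lemma corr_shift (z : ℕ → ℂ) (a L Q q p : ℕ) (hq : q < Q) (hpq : p ≤ q) :
    (∑ t ∈ Finset.range (Q + L),
      (if Q ≤ t + q ∧ t + q < Q + L then z (a + (t + q - Q)) else 0) *
      (starRingEnd ℂ) (if Q ≤ t + p ∧ t + p < Q + L then z (a + (t + p - Q)) else 0)) =
    corr z a (a + L) (q - p) := by
  rw [corr]
  symm
  refine Finset.sum_bij_ne_zero (fun n _ _ => n - a + Q - p) ?_ ?_ ?_ ?_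
  · intro n hn _; simp at *; omega
  · intro n hn _ m hm _ h; simp at *; omega
  · intro t ht hne
    simp only [Finset.mem_range] at ht
    by_cases h1 : Q ≤ t + q ∧ t + q < Q + L
    swap
    · simp [h1] at hne
    by_cases h2 : Q ≤ t + p ∧ t + p < Q + L
    swap
    · simp [h2] at hne
    rw [if_pos h1, if_pos h2] at hne
    refine ⟨a + (t + p - Q), by simp; omega, ?_, by omega⟩
    rwa [show a + (t + p - Q) + (q - p) = a + (t + q - Q) by omega]
  · intro n hn _
    rw [Finset.mem_Ico] at hn
    rw [if_pos (by omega), if_pos (by omega)]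
    rw [show a + (n - a + Q - p + q - Q) = n + (q - p) by omega,
      show a + (n - a + Q - p + p - Q) = n by omega]

/-- Averaging over Q shifts writes Q times the sum as a sum over Q + L windows of length Q.
Cauchy–Schwarz over the windows produces correlations that depend only on the distance of the two
shifts. -/
theorem van_der_corput_inequality (z : ℕ → ℂ) (hz : ∀ n, ‖z n‖ ≤ 1) (a b Q : ℕ) (hab : a ≤ b)
    (hQ : 1 ≤ Q) :
    ‖∑ n ∈ Finset.Ico a b, z n‖ ^ 2 ≤
      (Q + (b - a : ℕ) : ℝ) / Q * ((b - a : ℕ) + 2 * ∑ r ∈ Finset.Ico 1 Q, ‖corr z a b r‖) := by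
  obtain ⟨L, rfl⟩ := Nat.exists_eq_add_of_le hab
  rw [Nat.add_sub_cancel_left]
  -- Extension by zero, moved to start at Q so that every window begins at a natural number.
  set w : ℕ → ℂ := fun n => if Q ≤ n ∧ n < Q + L then z (a + (n - Q)) else 0 with hw
  have hsum : ∀ q ∈ Finset.range Q,
      ∑ t ∈ Finset.range (Q + L), w (t + q) = ∑ n ∈ Finset.Ico a (a + L), z n := by
    intro q hq
    rw [Finset.mem_range] at hq
    symm
    refine Finset.sum_bij_ne_zero (fun n _ _ => n - a + Q - q) ?_ ?_ ?_ ?_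
    · intro n hn _; simp at *; omega
    · intro n hn _ m hm _ h; simp at *; omega
    · intro t ht hne
      simp only [Finset.mem_range] at ht
      by_cases h1 : Q ≤ t + q ∧ t + q < Q + L
      swap
      · simp [hw, h1] at hne
      simp only [hw] at hne
      rw [if_pos h1] at hne
      exact ⟨a + (t + q - Q), by simp; omega, hne, by omega⟩
    · intro n hn _
      rw [Finset.mem_Ico] at hn
      simp only [hw]
      rw [if_pos (by omega)]
      rw [show a + (n - a + Q - q + q - Q) = n by omega]
  have h1 : (Q : ℂ) * ∑ n ∈ Finset.Ico a (a + L), z n =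
      ∑ t ∈ Finset.range (Q + L), ∑ q ∈ Finset.range Q, w (t + q) := by
    rw [Finset.sum_comm, Finset.sum_congr rfl hsum, Finset.sum_const, Finset.card_range,
      nsmul_eq_mul]
  have hcorr : ∀ q ∈ Finset.range Q, ∀ p ∈ Finset.range Q,
      ‖∑ t ∈ Finset.range (Q + L), w (t + q) * (starRingEnd ℂ) (w (t + p))‖ =
        ‖corr z a (a + L) (max q p - min q p)‖ := by
    intro q hq p hp
    rw [Finset.mem_range] at hq hp
    rcases le_total p q with h | h
    · rw [max_eq_left h, min_eq_right h, ← corr_shift z a L Q q p hq h]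
    · rw [max_eq_right h, min_eq_left h, ← corr_shift z a L Q p q hp h, ← Complex.norm_conj,
        map_sum]
      congr 1
      refine Finset.sum_congr rfl fun t _ => ?_
      rw [map_mul, Complex.conj_conj, mul_comm]
  have hzero : ‖corr z a (a + L) 0‖ ≤ L := by
    refine (norm_sum_le _ _).trans ?_
    have : ∀ n ∈ Finset.Ico a (a + L - 0), ‖z (n + 0) * (starRingEnd ℂ) (z n)‖ ≤ 1 := by
      intro n _
      rw [norm_mul, Complex.norm_conj]
      exact mul_le_one₀ (hz _) (norm_nonneg _) (hz _)
    refine (Finset.sum_le_sum this).trans ?_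
    simp
  have h2 : ∑ t ∈ Finset.range (Q + L), ‖∑ q ∈ Finset.range Q, w (t + q)‖ ^ 2 ≤
      Q * (L + 2 * ∑ r ∈ Finset.Ico 1 Q, ‖corr z a (a + L) r‖) := by
    refine (sum_norm_sum_sq_le _ _ fun t q => w (t + q)).trans ?_
    calc _ = ∑ q ∈ Finset.range Q, ∑ p ∈ Finset.range Q,
          ‖corr z a (a + L) (max q p - min q p)‖ :=
          Finset.sum_congr rfl fun q hq => Finset.sum_congr rfl fun p hp => hcorr q hq p hp
      _ ≤ ∑ q ∈ Finset.range Q, (L + 2 * ∑ r ∈ Finset.Ico 1 Q, ‖corr z a (a + L) r‖) := by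
          refine Finset.sum_le_sum fun q hq => ?_
          have := sum_dist_le (fun r => ‖corr z a (a + L) r‖) (fun r => norm_nonneg _) Q q
            (Finset.mem_range.1 hq)
          linarith
      _ = _ := by rw [Finset.sum_const, Finset.card_range, nsmul_eq_mul]
  have h3 := norm_sum_sq_le_card (Finset.range (Q + L))
    fun t => ∑ q ∈ Finset.range Q, w (t + q)
  rw [← h1, norm_mul, mul_pow, Finset.card_range, Complex.norm_natCast] at h3
  have hQ' : (0 : ℝ) < Q := by exact_mod_cast hQ
  rw [div_mul_eq_mul_div, le_div_iff₀ hQ']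
  have h4 := h3.trans (mul_le_mul_of_nonneg_left h2 (by positivity))
  push_cast at h4
  refine le_of_mul_le_mul_left ?_ hQ'
  linarith

/-! ### Sums with controlled fourth differences -/

lemma sum_inv_sqrt_le (Q : ℕ) : ∑ q ∈ Finset.Ico 1 Q, 1 / √(q : ℝ) ≤ 2 * √Q := by
  have key : ∀ Q : ℕ, ∑ q ∈ Finset.Ico 1 (Q + 1), 1 / √(q : ℝ) ≤ 2 * √Q := by
    intro Q
    induction Q with
    | zero => simp
    | succ Q ih =>
      rw [Finset.sum_Ico_succ_top (by omega)]
      have h1 : 0 < √((Q + 1 : ℕ) : ℝ) := Real.sqrt_pos.2 (by positivity)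
      have h2 : √((Q + 1 : ℕ) : ℝ) ^ 2 = Q + 1 := by rw [Real.sq_sqrt (by positivity)]; push_cast; ring
      have h3 : √(Q : ℝ) ^ 2 = Q := Real.sq_sqrt (by positivity)
      have h4 : 1 / √((Q + 1 : ℕ) : ℝ) ≤ 2 * √((Q + 1 : ℕ) : ℝ) - 2 * √(Q : ℝ) := by
        rw [div_le_iff₀ h1]
        nlinarith [sq_nonneg (√((Q + 1 : ℕ) : ℝ) - √(Q : ℝ))]
      linarith
  rcases Q with _ | Q
  · simp
  · refine (key Q).trans ?_
    gcongr; simp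

lemma corr_e (φ : ℕ → ℝ) (a b r : ℕ) :
    corr (fun n => e (φ n)) a b r = ∑ n ∈ Finset.Ico a (b - r), e (φ (n + r) - φ n) := by
  simp only [corr, e_mul_conj]

lemma van_der_corput_e (φ : ℕ → ℝ) (a b Q : ℕ) (N : ℝ) (hL : ((b - a : ℕ) : ℝ) ≤ 2 * N)
    (hQ : 1 ≤ Q) (hQN : (Q : ℝ) ≤ N) :
    ‖∑ n ∈ Finset.Ico a b, e (φ n)‖ ^ 2 ≤ 3 * N / Q * (2 * N + 2 * ∑ r ∈ Finset.Ico 1 Q,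
      ‖∑ n ∈ Finset.Ico a (b - r), e (φ (n + r) - φ n)‖) := by
  have hQ0 : (0 : ℝ) < Q := by exact_mod_cast hQ
  have hN : 0 < N := hQ0.trans_le hQN
  rcases le_or_gt b a with hab | hab
  · rw [Finset.Ico_eq_empty_of_le hab, Finset.sum_empty, norm_zero, zero_pow two_ne_zero]
    positivity
  have h := van_der_corput_inequality (fun n => e (φ n)) (fun n => (norm_e _).le) a b Q hab.le hQ
  simp only [corr_e] at h
  refine h.trans ?_
  gcongr
  linarith

/-- Van der Corput with shifts q < Q₁, then r < Q₂, leaves a phase whose second differences have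
order l·q·r. The first two terms are the diagonals of the two steps; the last two come from the
second derivative test. The condition `n + q + r + 2 ≤ b` lets φ be evaluated at b itself, one point
past the summation range. -/
theorem fourth_difference_bound (φ : ℕ → ℝ) (a b Q₁ Q₂ : ℕ) (N l ρ : ℝ)
    (hL : ((b - a : ℕ) : ℝ) ≤ 2 * N) (hl : 0 < l) (hρ : 1 ≤ ρ)
    (hQ₁ : 1 ≤ Q₁) (hQ₂ : 1 ≤ Q₂) (hQN₁ : (Q₁ : ℝ) ≤ N) (hQN₂ : (Q₂ : ℝ) ≤ N)
    (h1 : ∀ q r n : ℕ, 1 ≤ q → 1 ≤ r → a ≤ n → n + q + r + 2 ≤ b →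
      ∃ D : ℝ, l * (q * r) ≤ D ∧ D ≤ ρ * (l * (q * r)) ∧
      D = ((φ (n + 2 + r + q) - φ (n + 2 + r)) - (φ (n + 2 + q) - φ (n + 2))
        - ((φ (n + 1 + r + q) - φ (n + 1 + r)) - (φ (n + 1 + q) - φ (n + 1))))
        - (((φ (n + 1 + r + q) - φ (n + 1 + r)) - (φ (n + 1 + q) - φ (n + 1)))
        - ((φ (n + r + q) - φ (n + r)) - (φ (n + q) - φ n)))) :
    ‖∑ n ∈ Finset.Ico a b, e (φ n)‖ ^ 4 ≤
      72 * N ^ 4 / Q₁ ^ 2 + 432 * N ^ 4 / Q₂ + 4320 * ρ * N ^ 4 * √(l * (Q₁ * Q₂))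
        + 17280 * N ^ 3 / √(l * (Q₁ * Q₂)) := by
  have hQ₁0 : (0 : ℝ) < Q₁ := by exact_mod_cast hQ₁
  have hQ₂0 : (0 : ℝ) < Q₂ := by exact_mod_cast hQ₂
  have hN : 0 < N := hQ₁0.trans_le hQN₁
  have hinner : ∀ q ∈ Finset.Ico 1 Q₁, ∀ r ∈ Finset.Ico 1 Q₂,
      ‖∑ n ∈ Finset.Ico a (b - q - r), e ((φ (n + r + q) - φ (n + r)) - (φ (n + q) - φ n))‖ ≤
        10 * ρ * N * √(l * (Q₁ * Q₂)) + 10 / (√l * √q) * (1 / √r) := by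
    intro q hq r hr
    rw [Finset.mem_Ico] at hq hr
    have hq0 : (1 : ℝ) ≤ q := by exact_mod_cast hq.1
    have hr0 : (1 : ℝ) ≤ r := by exact_mod_cast hr.1
    have hlqr : 0 < l * (q * r : ℝ) := by positivity
    have hge : l * (q * r : ℝ) ≤ ρ * (l * (q * r : ℝ)) := le_mul_of_one_le_left hlqr.le hρ
    have h := second_difference_test
      (fun n => (φ (n + r + q) - φ (n + r)) - (φ (n + q) - φ n)) a (b - q - r) hlqr hge
      (fun n hn hnb => by
        obtain ⟨D, hD1, hD2, hD3⟩ := h1 q r n hq.1 hr.1 hn (by omega)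
        exact hD1.trans hD3.le)
      (fun n hn hnb => by
        obtain ⟨D, hD1, hD2, hD3⟩ := h1 q r n hq.1 hr.1 hn (by omega)
        exact hD3.symm.le.trans hD2)
    refine h.trans ?_
    have hlen : ((b - q - r - a : ℕ) : ℝ) ≤ 2 * N := by
      refine le_trans ?_ hL
      exact_mod_cast (by omega : b - q - r - a ≤ b - a)
    have hs : 0 < √(l * (q * r : ℝ)) := Real.sqrt_pos.2 hlqr
    have hss : √(l * (q * r : ℝ)) * √(l * (q * r : ℝ)) = l * (q * r) := Real.mul_self_sqrt hlqr.le
    have hmono : √(l * (q * r : ℝ)) ≤ √(l * (Q₁ * Q₂)) := by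
      apply Real.sqrt_le_sqrt
      have : (q : ℝ) ≤ Q₁ := by exact_mod_cast hq.2.le
      have : (r : ℝ) ≤ Q₂ := by exact_mod_cast hr.2.le
      gcongr
    calc (ρ * (l * (q * r : ℝ)) * ((b - q - r - a : ℕ) : ℝ) + 2) * (5 / √(l * (q * r : ℝ)))
        ≤ (ρ * (l * (q * r : ℝ)) * (2 * N) + 2) * (5 / √(l * (q * r : ℝ))) := by gcongr
      _ = 10 * ρ * N * √(l * (q * r : ℝ)) + 10 / √(l * (q * r : ℝ)) := by
          generalize √(l * (q * r : ℝ)) = σ at hs hss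
          rw [← hss]; field_simp; ring
      _ ≤ 10 * ρ * N * √(l * (Q₁ * Q₂)) + 10 / √(l * (q * r : ℝ)) := by gcongr
      _ = _ := by
          rw [show √(l * (q * r : ℝ)) = √l * (√q * √r) by
            rw [Real.sqrt_mul hl.le, Real.sqrt_mul (by positivity)]]
          field_simp
  have hmid : ∀ q ∈ Finset.Ico 1 Q₁,
      ‖∑ n ∈ Finset.Ico a (b - q), e (φ (n + q) - φ n)‖ ^ 2 ≤
        (6 * N ^ 2 / Q₂ + 60 * ρ * N ^ 2 * √(l * (Q₁ * Q₂))) +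
          120 * N / (√l * √Q₂) * (1 / √q) := by
    intro q hq
    have hlen : ((b - q - a : ℕ) : ℝ) ≤ 2 * N := by
      refine le_trans ?_ hL
      exact_mod_cast (by omega : b - q - a ≤ b - a)
    have h := van_der_corput_e (fun n => φ (n + q) - φ n) a (b - q) Q₂ N hlen hQ₂ hQN₂
    have h2 := Finset.sum_le_sum (hinner q hq)
    rw [Finset.sum_add_distrib, Finset.sum_const, Nat.card_Ico, nsmul_eq_mul, ← Finset.mul_sum] at h2
    have hc : ((Q₂ - 1 : ℕ) : ℝ) ≤ Q₂ := by exact_mod_cast (by omega : Q₂ - 1 ≤ Q₂)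
    have hq0 : (1 : ℝ) ≤ q := by exact_mod_cast (Finset.mem_Ico.1 hq).1
    have hsl : 0 < √l := Real.sqrt_pos.2 hl
    have hsq : 0 < √(q : ℝ) := Real.sqrt_pos.2 (by linarith)
    have hsQ : 0 < √(Q₂ : ℝ) := Real.sqrt_pos.2 hQ₂0
    have hsQQ : √(Q₂ : ℝ) * √(Q₂ : ℝ) = Q₂ := Real.mul_self_sqrt hQ₂0.le
    refine h.trans ?_
    calc _ ≤ 3 * N / Q₂ * (2 * N + 2 * (Q₂ * (10 * ρ * N * √(l * (Q₁ * Q₂))) +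
          10 / (√l * √q) * (2 * √Q₂))) := by
          gcongr
          refine h2.trans ?_
          gcongr
          exact sum_inv_sqrt_le Q₂
      _ = _ := by
          rw [show 3 * N / (Q₂ : ℝ) * (2 * N + 2 * (Q₂ * (10 * ρ * N * √(l * (Q₁ * Q₂))) +
            10 / (√l * √q) * (2 * √Q₂))) = 6 * N ^ 2 / Q₂ + 60 * ρ * N ^ 2 * √(l * (Q₁ * Q₂)) +
              120 * N * (√Q₂ / Q₂) / (√l * √q) by field_simp; ring]
          have : √(Q₂ : ℝ) / Q₂ = 1 / √Q₂ := by
            rw [div_eq_div_iff hQ₂0.ne' hsQ.ne', hsQQ, one_mul]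
          rw [this]; field_simp
  have hout := van_der_corput_e φ a b Q₁ N hL hQ₁ hQN₁
  set s : ℕ → ℝ := fun q => ‖∑ n ∈ Finset.Ico a (b - q), e (φ (n + q) - φ n)‖ with hs
  have hcs : (∑ q ∈ Finset.Ico 1 Q₁, s q) ^ 2 ≤ Q₁ * ∑ q ∈ Finset.Ico 1 Q₁, s q ^ 2 := by
    refine sq_sum_le_card_mul_sum_sq.trans ?_
    rw [Nat.card_Ico]
    have hc : ((Q₁ - 1 : ℕ) : ℝ) ≤ Q₁ := by exact_mod_cast (by omega : Q₁ - 1 ≤ Q₁)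
    gcongr
  have h2 := Finset.sum_le_sum hmid
  rw [Finset.sum_add_distrib, Finset.sum_const, Nat.card_Ico, nsmul_eq_mul, ← Finset.mul_sum] at h2
  have h3 : ∑ q ∈ Finset.Ico 1 Q₁, s q ^ 2 ≤
      Q₁ * (6 * N ^ 2 / Q₂ + 60 * ρ * N ^ 2 * √(l * (Q₁ * Q₂))) +
        120 * N / (√l * √Q₂) * (2 * √Q₁) := by
    refine h2.trans ?_
    have hc : ((Q₁ - 1 : ℕ) : ℝ) ≤ Q₁ := by exact_mod_cast (by omega : Q₁ - 1 ≤ Q₁)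
    gcongr
    exact sum_inv_sqrt_le Q₁
  have hsl : 0 < √l := Real.sqrt_pos.2 hl
  have hsQ1 : 0 < √(Q₁ : ℝ) := Real.sqrt_pos.2 hQ₁0
  have hsQ2 : 0 < √(Q₂ : ℝ) := Real.sqrt_pos.2 hQ₂0
  have hsQQ : √(Q₁ : ℝ) * √(Q₁ : ℝ) = Q₁ := Real.mul_self_sqrt hQ₁0.le
  have hsplit : √(l * (Q₁ * Q₂)) = √l * (√Q₁ * √Q₂) := by
    rw [Real.sqrt_mul hl.le, Real.sqrt_mul hQ₁0.le]
  calc ‖∑ n ∈ Finset.Ico a b, e (φ n)‖ ^ 4 = (‖∑ n ∈ Finset.Ico a b, e (φ n)‖ ^ 2) ^ 2 := by ring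
    _ ≤ (3 * N / Q₁ * (2 * N + 2 * ∑ q ∈ Finset.Ico 1 Q₁, s q)) ^ 2 := by gcongr
    _ ≤ (3 * N / Q₁) ^ 2 * (8 * N ^ 2 + 8 * (∑ q ∈ Finset.Ico 1 Q₁, s q) ^ 2) := by
        rw [mul_pow]; gcongr
        nlinarith [sq_nonneg (2 * N - 2 * ∑ q ∈ Finset.Ico 1 Q₁, s q)]
    _ ≤ (3 * N / Q₁) ^ 2 * (8 * N ^ 2 + 8 * (Q₁ *
        (Q₁ * (6 * N ^ 2 / Q₂ + 60 * ρ * N ^ 2 * √(l * (Q₁ * Q₂))) +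
        120 * N / (√l * √Q₂) * (2 * √Q₁)))) := by
        gcongr
        exact hcs.trans (by gcongr)
    _ = _ := by
        rw [hsplit]
        rw [show 17280 * N ^ 3 / (√l * (√(Q₁ : ℝ) * √(Q₂ : ℝ))) =
          17280 * N ^ 3 / (√l * √(Q₂ : ℝ)) * (1 / √Q₁) by field_simp]
        have : 1 / √(Q₁ : ℝ) = √Q₁ / Q₁ := by
          rw [div_eq_div_iff hsQ1.ne' hQ₁0.ne', hsQQ, one_mul]
        rw [this]; field_simp; ring

/-! ### Fourth differences of the phase -/

lemma difference_mem {f f' : ℝ → ℝ} {A B p q r : ℝ} (hr : 0 < r)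
    (hd : ∀ x, p ≤ x → x ≤ q → HasDerivAt f (f' x) x)
    (hA : ∀ x, p ≤ x → x ≤ q → A ≤ f' x) (hB : ∀ x, p ≤ x → x ≤ q → f' x ≤ B)
    {x : ℝ} (hx : p ≤ x) (hxr : x + r ≤ q) :
    r * A ≤ f (x + r) - f x ∧ f (x + r) - f x ≤ r * B := by
  obtain ⟨c, hc, hc2⟩ := exists_hasDerivAt_eq_slope f f' (a := x) (b := x + r) (by linarith)
    (fun t ht => (hd t (by linarith [ht.1]) (by linarith [ht.2])).continuousAt.continuousWithinAt)
    (fun t ht => hd t (by linarith [ht.1]) (by linarith [ht.2]))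
  have h1 : f (x + r) - f x = r * f' c := by
    rw [hc2, add_sub_cancel_left, mul_div_cancel₀ _ hr.ne']
  rw [h1]
  have := hA c (by linarith [hc.1]) (by linarith [hc.2])
  have := hB c (by linarith [hc.1]) (by linarith [hc.2])
  constructor <;> gcongr

lemma hasDerivAt_difference {f f' : ℝ → ℝ} {x r : ℝ} (h1 : HasDerivAt f (f' x) x)
    (h2 : HasDerivAt f (f' (x + r)) (x + r)) :
    HasDerivAt (fun t => f (t + r) - f t) (f' (x + r) - f' x) x :=
  (h2.comp_add_const x r).sub h1

/-- The mean value theorem is applied four times, with steps r, s, 1, 1, each time to a difference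
of the next lower derivative; bounds on f₄ thus pass to the mixed difference with the factor
r·s·1·1. -/
lemma fourth_difference_mem {f₀ f₁ f₂ f₃ f₄ : ℝ → ℝ} {A B p q : ℝ}
    (h₀ : ∀ x, p ≤ x → x ≤ q → HasDerivAt f₀ (f₁ x) x)
    (h₁ : ∀ x, p ≤ x → x ≤ q → HasDerivAt f₁ (f₂ x) x)
    (h₂ : ∀ x, p ≤ x → x ≤ q → HasDerivAt f₂ (f₃ x) x)
    (h₃ : ∀ x, p ≤ x → x ≤ q → HasDerivAt f₃ (f₄ x) x)
    (hA : ∀ x, p ≤ x → x ≤ q → A ≤ f₄ x) (hB : ∀ x, p ≤ x → x ≤ q → f₄ x ≤ B)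
    {r s x : ℝ} (hr : 0 < r) (hs : 0 < s) (hx : p ≤ x) (hxq : x + r + s + 2 ≤ q) :
    ∃ D : ℝ, A * (r * s) ≤ D ∧ D ≤ B * (r * s) ∧
      D = ((f₀ (x + 2 + s + r) - f₀ (x + 2 + s)) - (f₀ (x + 2 + r) - f₀ (x + 2))
        - ((f₀ (x + 1 + s + r) - f₀ (x + 1 + s)) - (f₀ (x + 1 + r) - f₀ (x + 1))))
        - (((f₀ (x + 1 + s + r) - f₀ (x + 1 + s)) - (f₀ (x + 1 + r) - f₀ (x + 1)))
        - ((f₀ (x + s + r) - f₀ (x + s)) - (f₀ (x + r) - f₀ x))) := by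
  have d0 : ∀ t, p ≤ t → t ≤ q - r →
      HasDerivAt (fun t => f₀ (t + r) - f₀ t) (f₁ (t + r) - f₁ t) t := fun t h h' =>
    hasDerivAt_difference (h₀ t h (by linarith)) (h₀ _ (by linarith) (by linarith))
  have d1 : ∀ t, p ≤ t → t ≤ q - r →
      HasDerivAt (fun t => f₁ (t + r) - f₁ t) (f₂ (t + r) - f₂ t) t := fun t h h' =>
    hasDerivAt_difference (h₁ t h (by linarith)) (h₁ _ (by linarith) (by linarith))
  have d2 : ∀ t, p ≤ t → t ≤ q - r →
      HasDerivAt (fun t => f₂ (t + r) - f₂ t) (f₃ (t + r) - f₃ t) t := fun t h h' =>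
    hasDerivAt_difference (h₂ t h (by linarith)) (h₂ _ (by linarith) (by linarith))
  have b3 : ∀ t, p ≤ t → t ≤ q - r →
      r * A ≤ f₃ (t + r) - f₃ t ∧ f₃ (t + r) - f₃ t ≤ r * B := fun t h h' =>
    difference_mem hr h₃ hA hB h (by linarith)
  have b2 : ∀ t, p ≤ t → t ≤ q - r - s → _ ∧ _ := fun t h h' =>
    difference_mem hs d2 (fun t h h' => (b3 t h h').1) (fun t h h' => (b3 t h h').2) h
      (by linarith)
  have e0 : ∀ t, p ≤ t → t ≤ q - r - s → HasDerivAt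
      (fun t => (f₀ (t + s + r) - f₀ (t + s)) - (f₀ (t + r) - f₀ t))
      ((f₁ (t + s + r) - f₁ (t + s)) - (f₁ (t + r) - f₁ t)) t := fun t h h' =>
    hasDerivAt_difference (f := fun t => f₀ (t + r) - f₀ t) (f' := fun t => f₁ (t + r) - f₁ t)
      (d0 t h (by linarith)) (d0 _ (by linarith) (by linarith))
  have e1 : ∀ t, p ≤ t → t ≤ q - r - s → HasDerivAt
      (fun t => (f₁ (t + s + r) - f₁ (t + s)) - (f₁ (t + r) - f₁ t))
      ((f₂ (t + s + r) - f₂ (t + s)) - (f₂ (t + r) - f₂ t)) t := fun t h h' =>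
    hasDerivAt_difference (f := fun t => f₁ (t + r) - f₁ t) (f' := fun t => f₂ (t + r) - f₂ t)
      (d1 t h (by linarith)) (d1 _ (by linarith) (by linarith))
  have b1 : ∀ t, p ≤ t → t ≤ q - r - s - 1 → _ ∧ _ := fun t h h' =>
    difference_mem one_pos e1 (fun t h h' => (b2 t h h').1) (fun t h h' => (b2 t h h').2) h
      (by linarith)
  have g0 : ∀ t, p ≤ t → t ≤ q - r - s - 1 → HasDerivAt
      (fun t => ((f₀ (t + 1 + s + r) - f₀ (t + 1 + s)) - (f₀ (t + 1 + r) - f₀ (t + 1))) -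
        ((f₀ (t + s + r) - f₀ (t + s)) - (f₀ (t + r) - f₀ t)))
      (((f₁ (t + 1 + s + r) - f₁ (t + 1 + s)) - (f₁ (t + 1 + r) - f₁ (t + 1))) -
        ((f₁ (t + s + r) - f₁ (t + s)) - (f₁ (t + r) - f₁ t))) t := fun t h h' =>
    hasDerivAt_difference
      (f := fun t => (f₀ (t + s + r) - f₀ (t + s)) - (f₀ (t + r) - f₀ t))
      (f' := fun t => (f₁ (t + s + r) - f₁ (t + s)) - (f₁ (t + r) - f₁ t))
      (e0 t h (by linarith)) (e0 _ (by linarith) (by linarith))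
  have b0 := difference_mem one_pos g0 (fun t h h' => (b1 t h h').1) (fun t h h' => (b1 t h h').2)
    hx (by linarith)
  refine ⟨_, ?_, ?_, rfl⟩
  · have := b0.1
    rw [show x + 1 + 1 = x + 2 by ring] at this
    linarith
  · have := b0.2
    rw [show x + 1 + 1 = x + 2 by ring] at this
    linarith

lemma hasDerivAt_rpow_linear (γ c u y x : ℝ) (j : ℕ) (hx : 0 < x * y + u) :
    HasDerivAt (fun x => c * (y ^ j * (x * y + u) ^ (γ - j)))
      (c * (γ - j) * (y ^ (j + 1) * (x * y + u) ^ (γ - (j + 1 : ℕ)))) x := by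
  have h1 : HasDerivAt (fun x => x * y + u) y x := by
    simpa using ((hasDerivAt_id x).mul_const y).add_const u
  have h2 := ((h1.rpow_const (p := γ - j) (Or.inl hx.ne')).const_mul (y ^ j)).const_mul c
  refine h2.congr_deriv ?_
  push_cast
  rw [show γ - (j + 1) = γ - j - 1 by ring]
  ring

lemma hasDerivAt_pow_mul_rpow {γ u x y : ℝ} (hxy : 0 < x * y + u) :
    HasDerivAt (fun y => y ^ 4 * (x * y + u) ^ (γ - 4))
      (y ^ 3 * (x * y + u) ^ (γ - 5) * (γ * (x * y) + 4 * u)) y := by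
  have h1 : HasDerivAt (fun y => x * y + u) x y := by
    simpa using ((hasDerivAt_id y).const_mul x).add_const u
  have h2 := (hasDerivAt_pow 4 y).mul (h1.rpow_const (p := γ - 4) (Or.inl hxy.ne'))
  refine HasDerivAt.congr_deriv h2 ?_
  rw [show γ - 4 - 1 = γ - 5 by ring, show γ - 4 = (γ - 5) + 1 by ring, Real.rpow_add_one hxy.ne']
  push_cast
  ring

/-- Size of the y-derivative of y^4(xy+u)^{γ-4}; its positivity is what prevents cancellation
between y and z. Here 5184 = 2^5·2·3^4, from xy+u ≤ 2xy, y ≤ 2Y and x ≤ 3N. -/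
lemma pow_mul_rpow_deriv_bounds {γ u x y N Y : ℝ} (hγ : 0 < γ) (hγ' : γ < 1) (hu : 0 ≤ u)
    (hN : 0 < N) (hY : 0 < Y) (hNx : N ≤ x) (hxN : x ≤ 3 * N) (hYy : Y ≤ y) (hyY : y ≤ 2 * Y)
    (huxy : u ≤ x * y) :
    γ / 5184 * (Y ^ (γ - 1) * N ^ (γ - 4)) ≤
        y ^ 3 * (x * y + u) ^ (γ - 5) * (γ * (x * y) + 4 * u) ∧
      y ^ 3 * (x * y + u) ^ (γ - 5) * (γ * (x * y) + 4 * u) ≤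
        5 * (Y ^ (γ - 1) * N ^ (γ - 4)) := by
  have hx : 0 < x := hN.trans_le hNx
  have hy : 0 < y := hY.trans_le hYy
  have hw : 0 < x * y := by positivity
  have hid : y ^ 3 * (x * y) ^ (γ - 5) * (x * y) = y ^ (γ - 1) * x ^ (γ - 4) := by
    rw [mul_assoc, ← Real.rpow_add_one hw.ne', show γ - 5 + 1 = γ - 4 by ring,
      Real.mul_rpow hx.le hy.le, ← Real.rpow_natCast y 3, mul_left_comm, ← Real.rpow_add hy]
    rw [mul_comm]; congr 2; push_cast; ring
  have two_le : ∀ (c z s : ℝ), 0 < z → 1 ≤ c → ∀ k : ℕ, -(k : ℝ) ≤ s →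
      z ^ s / c ^ k ≤ (c * z) ^ s := by
    intro c z s hz hc k hk
    have hc0 : 0 < c := by linarith
    rw [Real.mul_rpow hc0.le hz.le, div_eq_inv_mul, ← Real.rpow_natCast, ← Real.rpow_neg hc0.le]
    gcongr
  constructor
  · have h1 : (x * y) ^ (γ - 5) / 2 ^ 5 ≤ (x * y + u) ^ (γ - 5) :=
      (two_le 2 _ (γ - 5) hw (by norm_num) 5 (by push_cast; linarith)).trans
        (Real.rpow_le_rpow_of_nonpos (by positivity) (by linarith) (by linarith))
    have h2 : Y ^ (γ - 1) / 2 ^ 1 ≤ y ^ (γ - 1) :=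
      (two_le 2 _ (γ - 1) hY (by norm_num) 1 (by push_cast; linarith)).trans
        (Real.rpow_le_rpow_of_nonpos hy (by linarith) (by linarith))
    have h3 : N ^ (γ - 4) / 3 ^ 4 ≤ x ^ (γ - 4) :=
      (two_le 3 _ (γ - 4) hN (by norm_num) 4 (by push_cast; linarith)).trans
        (Real.rpow_le_rpow_of_nonpos hx (by linarith) (by linarith))
    calc γ / 5184 * (Y ^ (γ - 1) * N ^ (γ - 4)) =
          γ / 32 * (Y ^ (γ - 1) / 2 ^ 1 * (N ^ (γ - 4) / 3 ^ 4)) := by ring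
      _ ≤ γ / 32 * (y ^ (γ - 1) * x ^ (γ - 4)) := by gcongr
      _ = y ^ 3 * ((x * y) ^ (γ - 5) / 2 ^ 5) * (γ * (x * y)) := by rw [← hid]; ring
      _ ≤ y ^ 3 * (x * y + u) ^ (γ - 5) * (γ * (x * y) + 4 * u) := by
          gcongr; linarith
  · have h1 : (x * y + u) ^ (γ - 5) ≤ (x * y) ^ (γ - 5) :=
      Real.rpow_le_rpow_of_nonpos hw (by linarith) (by linarith)
    have h2 : y ^ (γ - 1) ≤ Y ^ (γ - 1) := Real.rpow_le_rpow_of_nonpos hY hYy (by linarith)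
    have h3 : x ^ (γ - 4) ≤ N ^ (γ - 4) := Real.rpow_le_rpow_of_nonpos hN hNx (by linarith)
    calc y ^ 3 * (x * y + u) ^ (γ - 5) * (γ * (x * y) + 4 * u)
        ≤ y ^ 3 * (x * y) ^ (γ - 5) * (5 * (x * y)) := by gcongr; nlinarith
      _ = 5 * (y ^ (γ - 1) * x ^ (γ - 4)) := by rw [← hid]; ring
      _ ≤ _ := by gcongr

/-- The phase of the bilinear sum. -/
noncomputable def phase (γ α u h x y : ℝ) : ℝ := x ^ 3 * y ^ 3 * α + h * (x * y + u) ^ γ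

lemma phase_comm (γ α u h x y : ℝ) : phase γ α u h x y = phase γ α u h y x := by
  rw [phase, phase, mul_comm x y, mul_comm (x ^ 3)]

/-- The positive constant `-γ(γ-1)(γ-2)(γ-3)`. -/
noncomputable def quarticCoeff (γ : ℝ) : ℝ := γ * (1 - γ) * (2 - γ) * (3 - γ)

lemma quarticCoeff_pos {γ : ℝ} (hγ : 0 < γ) (hγ' : γ < 1) : 0 < quarticCoeff γ := by
  have h1 : 0 < 1 - γ := by linarith
  have h2 : 0 < 2 - γ := by linarith
  have h3 : 0 < 3 - γ := by linarith
  rw [quarticCoeff]; positivity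

/-- The cubic α-part vanishes under a fourth difference. The fourth x-derivative of h(xy+u)^γ is a
negative multiple of y^4(xy+u)^{γ-4}, so subtracting the value at z > y leaves a positive quantity,
of order z - y by the mean value theorem in y. -/
theorem phase_fourth_difference {γ α u h N Y y z p q : ℝ} (hγ : 0 < γ) (hγ' : γ < 1)
    (hu : 0 ≤ u) (hu' : u ≤ 1) (hh : 0 < h) (hN : 0 < N) (hY : 0 < Y) (hNp : N ≤ p)
    (hp : 1 ≤ p) (hqN : q ≤ 3 * N) (hYy : Y ≤ y) (hy : 1 ≤ y) (hyz : y < z) (hzY : z ≤ 2 * Y)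
    {r s x : ℝ} (hr : 0 < r) (hs : 0 < s) (hx : p ≤ x) (hxq : x + r + s + 2 ≤ q) :
    let φ := fun x => phase γ α u h x y - phase γ α u h x z
    ∃ D : ℝ, (quarticCoeff γ * (γ / 5184) * (h * (z - y) * (Y ^ (γ - 1) * N ^ (γ - 4)))) *
        (r * s) ≤ D ∧
      D ≤ (quarticCoeff γ * 5 * (h * (z - y) * (Y ^ (γ - 1) * N ^ (γ - 4)))) * (r * s) ∧
      D = ((φ (x + 2 + s + r) - φ (x + 2 + s)) - (φ (x + 2 + r) - φ (x + 2))
        - ((φ (x + 1 + s + r) - φ (x + 1 + s)) - (φ (x + 1 + r) - φ (x + 1))))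
        - (((φ (x + 1 + s + r) - φ (x + 1 + s)) - (φ (x + 1 + r) - φ (x + 1)))
        - ((φ (x + s + r) - φ (x + s)) - (φ (x + r) - φ x))) := by
  intro φ
  -- All derivatives in one family: j is the order and c accumulates the factors γ, γ-1, and so on.
  set f : ℝ → ℕ → ℝ → ℝ := fun c j x =>
    h * (c * (y ^ j * (x * y + u) ^ (γ - j)) - c * (z ^ j * (x * z + u) ^ (γ - j))) with hf
  have hz1 : 1 ≤ z := hy.trans hyz.le
  have hpos : ∀ x, p ≤ x → 0 < x * y + u ∧ 0 < x * z + u := by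
    intro x hx
    have : 0 < x := by linarith
    constructor <;> positivity
  have hder : ∀ c j x, p ≤ x → HasDerivAt (f c j) (f (c * (γ - j)) (j + 1) x) x := by
    intro c j x hx
    exact ((hasDerivAt_rpow_linear γ c u y x j (hpos x hx).1).sub
      (hasDerivAt_rpow_linear γ c u z x j (hpos x hx).2)).const_mul h
  have hbd : ∀ x, p ≤ x → x ≤ q →
      (γ / 5184 * (Y ^ (γ - 1) * N ^ (γ - 4))) * (z - y) ≤
        z ^ 4 * (x * z + u) ^ (γ - 4) - y ^ 4 * (x * y + u) ^ (γ - 4) ∧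
      z ^ 4 * (x * z + u) ^ (γ - 4) - y ^ 4 * (x * y + u) ^ (γ - 4) ≤
        (5 * (Y ^ (γ - 1) * N ^ (γ - 4))) * (z - y) := by
    intro x hx hxq
    have hx1 : 1 ≤ x := hp.trans hx
    have hb : ∀ t, y ≤ t → t ≤ z → _ ∧ _ := fun t ht ht' =>
      pow_mul_rpow_deriv_bounds (x := x) (y := t) hγ hγ' hu hN hY (hNp.trans hx)
        (hxq.trans hqN) (hYy.trans ht) (ht'.trans hzY) (by nlinarith)
    have := difference_mem (f := fun t => t ^ 4 * (x * t + u) ^ (γ - 4)) (p := y) (q := z)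
      (r := z - y) (x := y) (by linarith)
      (fun t ht ht' => hasDerivAt_pow_mul_rpow (γ := γ) (u := u) (x := x) (by
        have : 0 < t := by linarith
        positivity)) (fun t ht ht' => (hb t ht ht').1) (fun t ht ht' => (hb t ht ht').2)
      le_rfl (by linarith)
    simp only [add_sub_cancel] at this
    constructor <;> linarith [this.1, this.2]
  have hc4 := (quarticCoeff_pos hγ hγ').le
  have hf4 : ∀ x, f (1 * (γ - (0 : ℕ)) * (γ - (1 : ℕ)) * (γ - (2 : ℕ)) * (γ - (3 : ℕ))) 4 x =
      quarticCoeff γ * h *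
        (z ^ 4 * (x * z + u) ^ (γ - 4) - y ^ 4 * (x * y + u) ^ (γ - 4)) := by
    intro x
    simp only [hf, quarticCoeff]
    push_cast
    ring
  obtain ⟨D, h1, h2, h3⟩ := fourth_difference_mem (p := p) (q := q)
    (A := quarticCoeff γ * (γ / 5184) * (h * (z - y) * (Y ^ (γ - 1) * N ^ (γ - 4))))
    (B := quarticCoeff γ * 5 * (h * (z - y) * (Y ^ (γ - 1) * N ^ (γ - 4))))
    (fun x hx _ => hder 1 0 x hx) (fun x hx _ => hder _ 1 x hx) (fun x hx _ => hder _ 2 x hx)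
    (fun x hx _ => hder _ 3 x hx)
    (fun x hx hxq => by
      rw [hf4]
      have := mul_le_mul_of_nonneg_left (hbd x hx hxq).1 (mul_nonneg hc4 hh.le)
      linarith)
    (fun x hx hxq => by
      rw [hf4]
      have := mul_le_mul_of_nonneg_left (hbd x hx hxq).2 (mul_nonneg hc4 hh.le)
      linarith) hr hs hx hxq
  refine ⟨D, h1, h2, ?_⟩
  have hφ : ∀ t, φ t = t ^ 3 * (α * (y ^ 3 - z ^ 3)) + f 1 0 t := by
    intro t; simp only [φ, phase, hf]; norm_num; ring
  rw [h3]
  simp only [hφ]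
  ring

/-! ### Correlations of two rough variables -/

lemma half_le_floor {x : ℝ} (hx : 1 ≤ x) : x / 2 ≤ (⌊x⌋₊ : ℝ) ∧ (⌊x⌋₊ : ℝ) ≤ x ∧ 1 ≤ ⌊x⌋₊ := by
  have h1 : 1 ≤ ⌊x⌋₊ := (Nat.one_le_floor_iff x).2 hx
  have h2 : (1 : ℝ) ≤ ⌊x⌋₊ := by exact_mod_cast h1
  have h3 := Nat.lt_floor_add_one x
  exact ⟨by linarith, Nat.floor_le (by linarith), h1⟩

/-- For each of the four terms of `fourth_difference_bound` to save Z^8 one needs Q₁ ≫ Z^4, Q₂ ≫ Z^8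
and Z^8/N ≤ G ≤ Z^{-8}, where G is about √(F Q₁ Q₂)/N². Take Q₁ ≈ Z^4 s and Q₂ ≈ Z^8 s, with s ≥ 1
minimal for the lower bound on G. The upper bound on G is F Z^28 ≤ N^4 when s = 1 and Z^16 ≤ N
otherwise; Q₂ ≤ N uses Z^20 ≤ F in the latter case. -/
lemma exists_shift_lengths {N F Z : ℝ} (hZ : 1 ≤ Z) (hF : 0 < F) (hZN : Z ^ 16 ≤ N)
    (hFN : F * Z ^ 28 ≤ N ^ 4) (hZF : Z ^ 20 ≤ F) :
    ∃ (Q₁ Q₂ : ℕ) (G : ℝ), 1 ≤ Q₁ ∧ 1 ≤ Q₂ ∧ (Q₁ : ℝ) ≤ N ∧ (Q₂ : ℝ) ≤ N ∧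
      Z ^ 4 / 2 ≤ Q₁ ∧ Z ^ 8 / 2 ≤ Q₂ ∧ 0 < G ∧ G ≤ 1 / Z ^ 8 ∧ Z ^ 8 / N ≤ G ∧
      F * (Q₁ * Q₂) / N ^ 4 ≤ G ^ 2 ∧ G ^ 2 / 4 ≤ F * (Q₁ * Q₂) / N ^ 4 := by
  have hZ0 : 0 < Z := by linarith
  have hN : 0 < N := (pow_pos hZ0 16).trans_le hZN
  have hf : 0 < √F := Real.sqrt_pos.2 hF
  have hff : √F ^ 2 = F := Real.sq_sqrt hF.le
  have hZf : Z ^ 10 ≤ √F := Real.le_sqrt_of_sq_le (by rw [← pow_mul]; exact hZF)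
  have hfN : √F * Z ^ 14 ≤ N ^ 2 := by
    refine le_of_sq_le_sq ?_ (by positivity)
    rw [mul_pow, hff]
    calc F * (Z ^ 14) ^ 2 = F * Z ^ 28 := by ring
      _ ≤ N ^ 4 := hFN
      _ = _ := by ring
  set s := max 1 (Z ^ 2 * N / √F) with hs
  have hs1 : 1 ≤ s := le_max_left _ _
  have hs2 : Z ^ 2 * N / √F ≤ s := le_max_right _ _
  have hs0 : 0 < s := by linarith
  have h4 : 1 ≤ Z ^ 4 * s := one_le_mul_of_one_le_of_one_le (one_le_pow₀ hZ) hs1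
  have h8 : 1 ≤ Z ^ 8 * s := one_le_mul_of_one_le_of_one_le (one_le_pow₀ hZ) hs1
  obtain ⟨a1, a2, a3⟩ := half_le_floor h4
  obtain ⟨b1, b2, b3⟩ := half_le_floor h8
  have h8N : Z ^ 8 * s ≤ N := by
    rcases max_choice 1 (Z ^ 2 * N / √F) with h | h
    · rw [hs, h, mul_one]
      exact (pow_le_pow_right₀ hZ (by norm_num)).trans hZN
    · rw [hs, h, mul_div_assoc', div_le_iff₀ hf]
      calc Z ^ 8 * (Z ^ 2 * N) = N * Z ^ 10 := by ring
        _ ≤ N * √F := by gcongr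
  have h4N : Z ^ 4 * s ≤ N := by
    refine le_trans ?_ h8N
    gcongr
    norm_num
  refine ⟨⌊Z ^ 4 * s⌋₊, ⌊Z ^ 8 * s⌋₊, Z ^ 6 * s * √F / N ^ 2, a3, b3, a2.trans h4N, b2.trans h8N,
    le_trans ?_ a1, le_trans ?_ b1, by positivity, ?_, ?_, ?_, ?_⟩
  · gcongr; nlinarith [pow_pos hZ0 4]
  · gcongr; nlinarith [pow_pos hZ0 8]
  · rw [div_le_div_iff₀ (by positivity) (by positivity), one_mul]
    rcases max_choice 1 (Z ^ 2 * N / √F) with h | h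
    · rw [hs, h, mul_one]
      calc Z ^ 6 * √F * Z ^ 8 = √F * Z ^ 14 := by ring
        _ ≤ _ := hfN
    · rw [hs, h]
      calc Z ^ 6 * (Z ^ 2 * N / √F) * √F * Z ^ 8 = Z ^ 16 * N := by field_simp
        _ ≤ N * N := by gcongr
        _ = _ := by ring
  · rw [div_le_div_iff₀ hN (by positivity)]
    rw [div_le_iff₀ hf] at hs2
    calc Z ^ 8 * N ^ 2 = Z ^ 6 * N * (Z ^ 2 * N) := by ring
      _ ≤ Z ^ 6 * N * (s * √F) := by gcongr
      _ = _ := by ring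
  · calc F * (⌊Z ^ 4 * s⌋₊ * ⌊Z ^ 8 * s⌋₊ : ℝ) / N ^ 4
        ≤ F * ((Z ^ 4 * s) * (Z ^ 8 * s)) / N ^ 4 := by gcongr
      _ = Z ^ 12 * s ^ 2 * √F ^ 2 / N ^ 4 := by rw [hff]; ring
      _ = _ := by ring
  · calc (Z ^ 6 * s * √F / N ^ 2) ^ 2 / 4 = Z ^ 12 * s ^ 2 * √F ^ 2 / N ^ 4 / 4 := by ring
      _ = F * ((Z ^ 4 * s / 2) * (Z ^ 8 * s / 2)) / N ^ 4 := by rw [hff]; ring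
      _ ≤ _ := by gcongr

theorem pair_bound {γ : ℝ} (hγ : 0 < γ) (hγ' : γ < 1) :
    ∃ C : ℝ, 0 < C ∧ ∀ (α u h N Y Z : ℝ) (a b y z : ℕ), 0 ≤ u → u ≤ 1 → 0 < h → 0 < Y → 1 ≤ Z →
      Z ^ 16 ≤ N → h * (N * Y) ^ γ * Z ^ 28 ≤ N ^ 4 → Z ^ 20 ≤ h * (N * Y) ^ γ →
      N ≤ a → (b : ℝ) ≤ 2 * N + 1 → Y ≤ y → (z : ℝ) ≤ 2 * Y → 1 ≤ y → y < z →
      ‖∑ x ∈ Finset.Ico a b, e (phase γ α u h x y - phase γ α u h x z)‖ ≤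
        C * (N / Z ^ 2 * √Y) / √((z : ℝ) - y) := by
  obtain ⟨c, hc⟩ : ∃ c, c = quarticCoeff γ * (γ / 5184) := ⟨_, rfl⟩
  have hq := quarticCoeff_pos hγ hγ'
  have hc0 : 0 < c := by rw [hc]; positivity
  obtain ⟨ρ, hρ⟩ : ∃ ρ, ρ = 25920 / γ := ⟨_, rfl⟩
  have hρ1 : 1 ≤ ρ := by rw [hρ, le_div_iff₀ hγ]; linarith
  obtain ⟨C, hC⟩ : ∃ C, C = 1152 + 4320 * ρ * √c + 34560 / √c := ⟨_, rfl⟩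
  have hsc : 0 < √c := Real.sqrt_pos.2 hc0
  have hC1 : 1 ≤ C := by
    have : 0 ≤ 4320 * ρ * √c := by positivity
    have : 0 ≤ 34560 / √c := by positivity
    linarith
  refine ⟨C, by linarith, ?_⟩
  intro α u h N Y Z a b y z hu hu' hh hY hZ hZN hFN hZF hNa hbN hYy hzY hy hyz
  have hZ0 : 0 < Z := by linarith
  have hN1 : 1 ≤ N := (one_le_pow₀ hZ).trans hZN
  have hN : 0 < N := by linarith
  have hyz' : (y : ℝ) < z := by exact_mod_cast hyz
  have hy1 : (1 : ℝ) ≤ y := by exact_mod_cast hy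
  set d := (z : ℝ) - y with hd
  have hd0 : 0 < d := by linarith
  set F := h * (N * Y) ^ γ with hFdef
  have hF : 0 < F := by positivity
  set t := d / Y with ht
  have ht0 : 0 < t := by positivity
  have ht1 : t ≤ 1 := by rw [ht, div_le_one hY]; linarith
  obtain ⟨Q₁, Q₂, G, hQ₁, hQ₂, hQN₁, hQN₂, hZQ₁, hZQ₂, hG, hGZ, hZG, hQG, hGQ⟩ :=
    exists_shift_lengths hZ hF hZN hFN hZF
  set l := c * (h * d * (Y ^ (γ - 1) * N ^ (γ - 4))) with hl
  have hlF : l = c * t * F / N ^ 4 := by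
    have h1 : Y ^ (γ - 1) = Y ^ γ / Y := Real.rpow_sub_one hY.ne' γ
    have h2 : N ^ (γ - 4) = N ^ γ / N ^ 4 := by
      rw [Real.rpow_sub hN, show (4 : ℝ) = ((4 : ℕ) : ℝ) by norm_num, Real.rpow_natCast]
    rw [hl, h1, h2, hFdef, Real.mul_rpow hN.le hY.le, ht]
    ring
  have hl0 : 0 < l := by positivity
  rcases le_or_gt b a with hab | hab
  · rw [Finset.Ico_eq_empty_of_le hab, Finset.sum_empty, norm_zero]
    positivity
  have hlen : ((b - a : ℕ) : ℝ) ≤ 2 * N := by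
    rw [Nat.cast_sub hab.le]; linarith
  have hS := fourth_difference_bound
    (fun x => phase γ α u h x y - phase γ α u h x z) a b Q₁ Q₂ N l ρ hlen hl0 hρ1 hQ₁ hQ₂ hQN₁
    hQN₂ (by
      intro q r n hq hr hn hnb
      have hq' : (0 : ℝ) < q := by exact_mod_cast hq
      have hr' : (0 : ℝ) < r := by exact_mod_cast hr
      obtain ⟨D, h1, h2, h3⟩ := phase_fourth_difference (γ := γ) (α := α) (u := u) (h := h) (N := N)
        (Y := Y) (y := y) (z := z) (p := a) (q := b) (r := q) (s := r) (x := n) hγ hγ' hu hu' hh hN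
        hY hNa (by linarith) (by linarith) hYy hy1 hyz' hzY hq' hr' (by exact_mod_cast hn)
        (by exact_mod_cast hnb)
      refine ⟨D, by rw [hl, hd, hc]; exact h1, ?_, ?_⟩
      · have : quarticCoeff γ * 5 = ρ * c := by rw [hρ, hc]; field_simp; norm_num
        rw [this] at h2
        rw [hl, hd]; linarith
      · rw [h3]; push_cast; ring)
  have hlQ : l * (Q₁ * Q₂) = c * t * (F * (Q₁ * Q₂) / N ^ 4) := by rw [hlF]; ring
  have hst : 0 < √t := Real.sqrt_pos.2 ht0
  have hst1 : √t ≤ 1 := Real.sqrt_le_one.2 ht1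
  have hup : √(l * (Q₁ * Q₂)) ≤ √c / Z ^ 8 := by
    calc √(l * (Q₁ * Q₂)) ≤ √(c * G ^ 2) := by
          apply Real.sqrt_le_sqrt
          rw [hlQ]
          calc c * t * (F * (Q₁ * Q₂) / N ^ 4) ≤ c * 1 * G ^ 2 := by gcongr
            _ = _ := by ring
      _ = √c * G := by rw [Real.sqrt_mul hc0.le, Real.sqrt_sq hG.le]
      _ ≤ √c * (1 / Z ^ 8) := by gcongr
      _ = _ := by ring
  have hlow : √c * √t * (Z ^ 8 / N) / 2 ≤ √(l * (Q₁ * Q₂)) := by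
    calc √c * √t * (Z ^ 8 / N) / 2 ≤ √c * √t * G / 2 := by gcongr
      _ = √(c * t * (G / 2) ^ 2) := by
          rw [Real.sqrt_mul (by positivity), Real.sqrt_mul hc0.le, Real.sqrt_sq (by positivity)]
          ring
      _ ≤ _ := by
          apply Real.sqrt_le_sqrt
          rw [hlQ]
          calc c * t * (G / 2) ^ 2 = c * t * (G ^ 2 / 4) := by ring
            _ ≤ _ := by gcongr
  have hlow0 : 0 < √c * √t * (Z ^ 8 / N) / 2 := by positivity
  set S := ‖∑ x ∈ Finset.Ico a b, e (phase γ α u h x y - phase γ α u h x z)‖ with hSdef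
  have hst2 : t ^ 2 ≤ √t := by
    have h1 : √t ^ 2 = t := Real.sq_sqrt ht0.le
    calc t ^ 2 = (√t ^ 2) ^ 2 := by rw [h1]
      _ = √t ^ 4 := by ring
      _ ≤ √t := pow_le_of_le_one hst.le hst1 (by norm_num)
  refine (pow_le_pow_iff_left₀ (n := 4) (norm_nonneg _) (by positivity)
    (by norm_num)).1 (hS.trans ?_)
  clear_value l t F d
  calc _ ≤ 72 * N ^ 4 / (Z ^ 4 / 2) ^ 2 + 432 * N ^ 4 / (Z ^ 8 / 2)
        + 4320 * ρ * N ^ 4 * (√c / Z ^ 8) + 17280 * N ^ 3 / (√c * √t * (Z ^ 8 / N) / 2) := by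
        gcongr
    _ = N ^ 4 / Z ^ 8 * (1152 * 1 + 4320 * ρ * √c * 1 + 34560 / √c * (1 / √t)) := by
        field_simp; ring
    _ ≤ N ^ 4 / Z ^ 8 * (1152 * (1 / √t) + 4320 * ρ * √c * (1 / √t) + 34560 / √c * (1 / √t)) := by
        have : 1 ≤ 1 / √t := by rw [le_div_iff₀ hst]; linarith
        gcongr
    _ = N ^ 4 / Z ^ 8 * C * (1 / √t) := by rw [hC]; ring
    -- Weakening t^{-1/2} to t^{-2} costs nothing later: after the fourth root, (Y/d)^{1/2} is still
    -- summable over d with the right size.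
    _ ≤ N ^ 4 / Z ^ 8 * C ^ 4 * (1 / t ^ 2) := by
        have : C ≤ C ^ 4 := le_self_pow₀ hC1 (by norm_num)
        gcongr
    _ = C ^ 4 * (N ^ 4 / Z ^ 8 * Y ^ 2) / d ^ 2 := by rw [ht]; field_simp
    _ = C ^ 4 * (N ^ 4 / Z ^ 8 * (√Y ^ 2) ^ 2) / (√d ^ 2) ^ 2 := by
        rw [Real.sq_sqrt hY.le, Real.sq_sqrt hd0.le]
    _ = _ := by ring

/-! ### Bilinear sums -/

/-- Opening the square gives at most L rows; in each, the diagonal entry costs B²|U| and the others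
sum to at most 4W√L because ∑ r^{-1/2} ≤ 2√L. -/
theorem block_mean_square (U T : Finset ℕ) (Ψ : ℕ → ℕ → ℂ) (p L : ℕ) (B W : ℝ) (hW : 0 ≤ W)
    (hT : T ⊆ Finset.Ico p (p + L)) (hΨ : ∀ x ∈ U, ∀ y ∈ T, ‖Ψ x y‖ ≤ B)
    (hpair : ∀ y ∈ T, ∀ z ∈ T, y < z →
      ‖∑ x ∈ U, Ψ x y * (starRingEnd ℂ) (Ψ x z)‖ ≤ W / √((z : ℝ) - y)) :
    ∑ x ∈ U, ‖∑ y ∈ T, Ψ x y‖ ^ 2 ≤ L * (B ^ 2 * U.card + 4 * W * √L) := by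
  set c : ℕ → ℝ := fun r => if r = 0 then B ^ 2 * U.card else W / √(r : ℝ) with hc
  have hc0 : ∀ r, 0 ≤ c r := by
    intro r; simp only [hc]; split_ifs <;> positivity
  have hcorr : ∀ y ∈ T, ∀ z ∈ T,
      ‖∑ x ∈ U, Ψ x y * (starRingEnd ℂ) (Ψ x z)‖ ≤ c (max y z - min y z) := by
    intro y hy z hz
    rcases lt_trichotomy y z with h | h | h
    · rw [max_eq_right h.le, min_eq_left h.le]
      simp only [hc]
      rw [if_neg (by omega), Nat.cast_sub h.le]
      exact hpair y hy z hz h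
    · subst h
      simp only [hc, max_self, min_self, Nat.sub_self, if_true]
      refine (norm_sum_le _ _).trans ?_
      have : ∀ x ∈ U, ‖Ψ x y * (starRingEnd ℂ) (Ψ x y)‖ ≤ B ^ 2 := by
        intro x hx
        rw [norm_mul, Complex.norm_conj, ← sq]
        exact pow_le_pow_left₀ (norm_nonneg _) (hΨ x hx y hy) 2
      refine (Finset.sum_le_sum this).trans ?_
      rw [Finset.sum_const, nsmul_eq_mul, mul_comm]
    · rw [max_eq_left h.le, min_eq_right h.le]
      simp only [hc]
      rw [if_neg (by omega), Nat.cast_sub h.le]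
      refine le_trans (le_of_eq ?_) (hpair z hz y hy h)
      rw [← Complex.norm_conj, map_sum]
      congr 1
      refine Finset.sum_congr rfl fun t _ => ?_
      rw [map_mul, Complex.conj_conj, mul_comm]
  have hrow : ∀ y ∈ T, ∑ z ∈ T, ‖∑ x ∈ U, Ψ x y * (starRingEnd ℂ) (Ψ x z)‖ ≤
      B ^ 2 * U.card + 4 * W * √L := by
    intro y hy
    have hyI := Finset.mem_Ico.1 (hT hy)
    calc _ ≤ ∑ z ∈ T, c (max y z - min y z) := Finset.sum_le_sum fun z hz => hcorr y hy z hz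
      _ ≤ ∑ z ∈ Finset.Ico p (p + L), c (max y z - min y z) :=
          Finset.sum_le_sum_of_subset_of_nonneg hT fun _ _ _ => hc0 _
      _ = ∑ z ∈ Finset.range L, c (max (y - p) z - min (y - p) z) := by
          rw [Finset.sum_Ico_eq_sum_range, Nat.add_sub_cancel_left]
          refine Finset.sum_congr rfl fun z _ => ?_
          congr 1; omega
      _ ≤ c 0 + 2 * ∑ r ∈ Finset.Ico 1 L, c r := sum_dist_le c hc0 L _ (by omega)
      _ = B ^ 2 * U.card + 2 * (W * ∑ r ∈ Finset.Ico 1 L, 1 / √(r : ℝ)) := by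
          have : ∑ r ∈ Finset.Ico 1 L, c r = ∑ r ∈ Finset.Ico 1 L, W * (1 / √(r : ℝ)) := by
            refine Finset.sum_congr rfl fun r hr => ?_
            rw [Finset.mem_Ico] at hr
            simp only [hc]
            rw [if_neg (by omega), mul_one_div]
          rw [this, ← Finset.mul_sum]
          simp [hc]
      _ ≤ B ^ 2 * U.card + 2 * (W * (2 * √L)) := by
          gcongr
          exact sum_inv_sqrt_le L
      _ = _ := by ring
  refine (sum_norm_sum_sq_le U T Ψ).trans ((Finset.sum_le_sum hrow).trans ?_)
  rw [Finset.sum_const, nsmul_eq_mul]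
  have hcard : (T.card : ℝ) ≤ L := by
    have := Finset.card_le_card hT
    rw [Nat.card_Ico, Nat.add_sub_cancel_left] at this
    exact_mod_cast this
  gcongr

theorem bilinear_bound (U T : Finset ℕ) (Ψ : ℕ → ℕ → ℂ) (b : ℕ → ℂ) (p L : ℕ) (B B' W : ℝ)
    (hW : 0 ≤ W) (hT : T ⊆ Finset.Ico p (p + L)) (hΨ : ∀ x ∈ U, ∀ y ∈ T, ‖Ψ x y‖ ≤ B)
    (hb : ∀ x ∈ U, ‖b x‖ ≤ B')
    (hpair : ∀ y ∈ T, ∀ z ∈ T, y < z →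
      ‖∑ x ∈ U, Ψ x y * (starRingEnd ℂ) (Ψ x z)‖ ≤ W / √((z : ℝ) - y)) :
    ‖∑ x ∈ U, b x * ∑ y ∈ T, Ψ x y‖ ^ 2 ≤
      U.card * (B' ^ 2 * (L * (B ^ 2 * U.card + 4 * W * √L))) := by
  refine (norm_sum_sq_le_card _ _).trans ?_
  refine mul_le_mul_of_nonneg_left ?_ (Nat.cast_nonneg _)
  refine le_trans ?_ (mul_le_mul_of_nonneg_left
    (block_mean_square U T Ψ p L B W hW hT hΨ hpair) (sq_nonneg B'))
  rw [Finset.mul_sum]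
  refine Finset.sum_le_sum fun x hx => ?_
  rw [norm_mul, mul_pow]
  have := hb x hx
  gcongr

/-! ### Sums over arbitrary intervals by dyadic blocks -/

/-- The sum of `f` over the `i`-th dyadic block of length `2 ^ j` after `p`. -/
noncomputable def blockSum (f : ℕ → ℂ) (p j i : ℕ) : ℂ :=
  ∑ y ∈ Finset.Ico (p + i * 2 ^ j) (p + (i + 1) * 2 ^ j), f y

/-- Clearing the lowest J binary digits of n removes at most one aligned block at each level j < J.
-/
lemma prefix_sub_le (f : ℕ → ℂ) (p L n : ℕ) (hn : n ≤ L) (M : ℕ → ℝ) (hM0 : ∀ j, 0 ≤ M j)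
    (hM : ∀ j i, (i + 1) * 2 ^ j ≤ L → ‖blockSum f p j i‖ ≤ M j) (J : ℕ) :
    ‖∑ y ∈ Finset.Ico p (p + n), f y - ∑ y ∈ Finset.Ico p (p + n / 2 ^ J * 2 ^ J), f y‖ ≤
      ∑ j ∈ Finset.range J, M j := by
  induction J with
  | zero => simp
  | succ J ih =>
    rw [Finset.sum_range_succ]
    refine (norm_sub_le_norm_sub_add_norm_sub _
      (∑ y ∈ Finset.Ico p (p + n / 2 ^ J * 2 ^ J), f y) _).trans (add_le_add ih ?_)
    set i := n / 2 ^ (J + 1) with hi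
    have h1 : n / 2 ^ J / 2 = i := by rw [hi, pow_succ, Nat.div_div_eq_div_mul]
    have h2 : n / 2 ^ J * 2 ^ J ≤ n := Nat.div_mul_le_self n (2 ^ J)
    rw [show i * 2 ^ (J + 1) = (2 * i) * 2 ^ J by rw [pow_succ]; ring]
    rcases Nat.mod_two_eq_zero_or_one (n / 2 ^ J) with h | h
    · rw [show n / 2 ^ J = 2 * i by omega, sub_self, norm_zero]
      exact hM0 J
    · rw [show n / 2 ^ J = 2 * i + 1 by omega] at h2 ⊢
      rw [← Finset.sum_Ico_consecutive f (m := p) (n := p + 2 * i * 2 ^ J)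
        (k := p + (2 * i + 1) * 2 ^ J) (by omega) (by gcongr; omega), add_sub_cancel_left]
      exact hM J (2 * i) (h2.trans hn)

lemma interval_sum_le (f : ℕ → ℂ) (p L s t J : ℕ) (hst : Finset.Ico s t ⊆ Finset.Ico p (p + L))
    (hJ : L < 2 ^ J) (M : ℕ → ℝ) (hM0 : ∀ j, 0 ≤ M j)
    (hM : ∀ j i, (i + 1) * 2 ^ j ≤ L → ‖blockSum f p j i‖ ≤ M j) :
    ‖∑ y ∈ Finset.Ico s t, f y‖ ≤ 2 * ∑ j ∈ Finset.range J, M j := by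
  have hpre : ∀ n, n ≤ L → ‖∑ y ∈ Finset.Ico p (p + n), f y‖ ≤ ∑ j ∈ Finset.range J, M j := by
    intro n hn
    have := prefix_sub_le f p L n hn M hM0 hM J
    rw [Nat.div_eq_of_lt (hn.trans_lt hJ)] at this
    simpa using this
  rcases le_or_gt t s with h | h
  · rw [Finset.Ico_eq_empty_of_le h, Finset.sum_empty, norm_zero]
    have := Finset.sum_nonneg fun j (_ : j ∈ Finset.range J) => hM0 j
    linarith
  · have h1 := Finset.mem_Ico.1 (hst (Finset.left_mem_Ico.2 h))
    have h2 := Finset.mem_Ico.1 (hst (Finset.mem_Ico.2 (⟨by omega, by omega⟩ : s ≤ t - 1 ∧ t - 1 < t)))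
    obtain ⟨i, rfl⟩ := Nat.exists_eq_add_of_le h1.1
    obtain ⟨k, rfl⟩ : ∃ k, t = p + k := ⟨t - p, by omega⟩
    have h3 := Finset.sum_Ico_consecutive f (m := p) (n := p + i) (k := p + k) (by omega) (by omega)
    rw [← sub_eq_of_eq_add' h3.symm]
    refine (norm_sub_le _ _).trans ?_
    have := hpre i (by omega)
    have := hpre k (by omega)
    linarith

lemma sum_geometric_le {r : ℝ} (hr : 0 < r) (hr4 : r ^ 4 = 2) (J : ℕ) :
    ∑ j ∈ Finset.range J, r ^ j ≤ 6 * r ^ J := by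
  have h1 : 7 / 6 ≤ r := by
    by_contra h
    have : r ^ 4 < (7 / 6) ^ 4 := pow_lt_pow_left₀ (not_le.1 h) hr.le (by norm_num)
    norm_num at this; linarith
  induction J with
  | zero => simp
  | succ J ih =>
    rw [Finset.sum_range_succ, pow_succ]
    have := pow_pos hr J
    nlinarith

/-- An interval is a difference of two prefixes, and a prefix uses at most one block per level. That
block, which depends on x, is dominated by the square root of the sum of squares over all blocks of
its level, whose mean over x is `block_mean_square`. Only the diagonal part pays a logarithm: the
off-diagonal part grows like 2^{j/4} and sums geometrically. -/
theorem maximal_bound (U : Finset ℕ) (Ψ : ℕ → ℕ → ℂ) (p L : ℕ) (B W : ℝ) (hL : 1 ≤ L)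
    (hB : 0 ≤ B) (hW : 0 ≤ W)
    (hΨ : ∀ x ∈ U, ∀ y ∈ Finset.Ico p (p + L), ‖Ψ x y‖ ≤ B)
    (hpair : ∀ y ∈ Finset.Ico p (p + L), ∀ z ∈ Finset.Ico p (p + L), y < z →
      ‖∑ x ∈ U, Ψ x y * (starRingEnd ℂ) (Ψ x z)‖ ≤ W / √((z : ℝ) - y))
    (I : ℕ → Finset ℕ) (hI : ∀ x ∈ U, ∃ s t, I x = Finset.Ico s t)
    (hIL : ∀ x ∈ U, I x ⊆ Finset.Ico p (p + L)) :
    ∑ x ∈ U, ‖∑ y ∈ I x, Ψ x y‖ ≤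
      2 * (Nat.log 2 L + 1) * (B * U.card * √L) + 48 * √(U.card * L * W * √L) := by
  set J := Nat.log 2 L + 1 with hJ
  have hLJ : L < 2 ^ J := Nat.lt_pow_succ_log_self (by norm_num) L
  have hJL : 2 ^ J ≤ 2 * L := by
    rw [hJ, pow_succ, mul_comm]
    exact Nat.mul_le_mul_left 2 (Nat.pow_log_le_self 2 (by omega))
  set M : ℕ → ℕ → ℝ := fun x j =>
    √(∑ i ∈ Finset.range (L / 2 ^ j), ‖blockSum (Ψ x) p j i‖ ^ 2) with hM
  have hidx : ∀ j i, i < L / 2 ^ j ↔ (i + 1) * 2 ^ j ≤ L := by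
    intro j i
    rw [← Nat.succ_le_iff, Nat.le_div_iff_mul_le (by positivity)]
  have hpt : ∀ x ∈ U, ‖∑ y ∈ I x, Ψ x y‖ ≤ 2 * ∑ j ∈ Finset.range J, M x j := by
    intro x hx
    obtain ⟨s, t, hst⟩ := hI x hx
    have := hIL x hx
    rw [hst] at this ⊢
    refine interval_sum_le _ p L s t J this hLJ _ (fun j => Real.sqrt_nonneg _) fun j i hi => ?_
    refine Real.le_sqrt_of_sq_le ?_
    exact Finset.single_le_sum (f := fun i => ‖blockSum (Ψ x) p j i‖ ^ 2)
      (fun _ _ => sq_nonneg _) (Finset.mem_range.2 ((hidx j i).2 hi))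
  obtain ⟨r, hr0, hr4⟩ : ∃ r : ℝ, 0 < r ∧ r ^ 4 = 2 := by
    refine ⟨√√2, by positivity, ?_⟩
    rw [show (4 : ℕ) = 2 * 2 by norm_num, pow_mul, Real.sq_sqrt (by positivity),
      Real.sq_sqrt (by positivity)]
  have hsq2 : ∀ j : ℕ, √((2 ^ j : ℕ) : ℝ) = (r ^ j) ^ 2 := by
    intro j
    rw [Real.sqrt_eq_iff_mul_self_eq (by positivity) (by positivity)]
    push_cast
    rw [← hr4]; ring
  have hlevel : ∀ j, ∑ x ∈ U, M x j ≤
      B * U.card * √L + 2 * √(U.card * L * W) * r ^ j := by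
    intro j
    have h1 : (∑ x ∈ U, M x j) ^ 2 ≤ U.card * ∑ x ∈ U, M x j ^ 2 := sq_sum_le_card_mul_sum_sq
    have h2 : ∑ x ∈ U, M x j ^ 2 ≤ L * (B ^ 2 * U.card + 4 * W * (r ^ j) ^ 2) := by
      calc ∑ x ∈ U, M x j ^ 2
          = ∑ x ∈ U, ∑ i ∈ Finset.range (L / 2 ^ j), ‖blockSum (Ψ x) p j i‖ ^ 2 :=
            Finset.sum_congr rfl fun x _ => Real.sq_sqrt (by positivity)
        _ = ∑ i ∈ Finset.range (L / 2 ^ j), ∑ x ∈ U, ‖blockSum (Ψ x) p j i‖ ^ 2 :=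
            Finset.sum_comm
        _ ≤ ∑ i ∈ Finset.range (L / 2 ^ j),
              ((2 ^ j : ℕ) : ℝ) * (B ^ 2 * U.card + 4 * W * (r ^ j) ^ 2) := by
            refine Finset.sum_le_sum fun i hi => ?_
            have hi' := (hidx j i).1 (Finset.mem_range.1 hi)
            have hsub : Finset.Ico (p + i * 2 ^ j) (p + (i + 1) * 2 ^ j) ⊆
                Finset.Ico p (p + L) := Finset.Ico_subset_Ico (by omega) (by omega)
            rw [← hsq2]
            refine block_mean_square U _ Ψ (p + i * 2 ^ j) (2 ^ j) B W hW ?_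
              (fun x hx y hy => hΨ x hx y (hsub hy))
              (fun y hy z hz => hpair y (hsub hy) z (hsub hz))
            exact le_of_eq (by congr 1; ring)
        _ = ((L / 2 ^ j * 2 ^ j : ℕ) : ℝ) * (B ^ 2 * U.card + 4 * W * (r ^ j) ^ 2) := by
            rw [Finset.sum_const, Finset.card_range, nsmul_eq_mul, Nat.cast_mul]; ring
        _ ≤ _ := by
            have : ((L / 2 ^ j * 2 ^ j : ℕ) : ℝ) ≤ L := by
              exact_mod_cast Nat.div_mul_le_self L (2 ^ j)
            gcongr
    refine le_of_sq_le_sq ?_ (by positivity)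
    refine h1.trans ((mul_le_mul_of_nonneg_left h2 (Nat.cast_nonneg _)).trans ?_)
    have hs1 : √(L : ℝ) ^ 2 = L := Real.sq_sqrt (by positivity)
    have hs2 : √(U.card * L * W : ℝ) ^ 2 = U.card * L * W := Real.sq_sqrt (by positivity)
    have hcross : 0 ≤ B * U.card * √L * (2 * √(U.card * L * W) * r ^ j) := by positivity
    calc (U.card : ℝ) * (L * (B ^ 2 * U.card + 4 * W * (r ^ j) ^ 2))
        = (B * U.card) ^ 2 * L + 4 * (U.card * L * W) * (r ^ j) ^ 2 := by ring
      _ = (B * U.card * √L) ^ 2 + (2 * √(U.card * L * W) * r ^ j) ^ 2 := by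
          conv_lhs => rw [← hs1]
          rw [mul_pow (2 * √(U.card * L * W)), mul_pow 2, hs2, hs1]; rw [mul_pow _ (√(L : ℝ)), hs1]; ring
      _ ≤ _ := by rw [add_sq]; linarith
  have hgeo : ∑ j ∈ Finset.range J, r ^ j ≤ 12 * √√L := by
    refine (sum_geometric_le hr0 hr4 J).trans ?_
    have h1 : (r ^ J) ^ 4 ≤ (2 * √√(L : ℝ)) ^ 4 := by
      calc (r ^ J) ^ 4 = (2 ^ J : ℕ) := by push_cast; rw [← hr4]; ring
        _ ≤ ((2 * L : ℕ) : ℝ) := by exact_mod_cast hJL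
        _ ≤ 16 * L := by push_cast; nlinarith [(Nat.cast_nonneg L : (0 : ℝ) ≤ L)]
        _ = 16 * (√√(L : ℝ) ^ 2) ^ 2 := by
            rw [Real.sq_sqrt (by positivity), Real.sq_sqrt (by positivity)]
        _ = _ := by ring
    have := (pow_le_pow_iff_left₀ (by positivity) (by positivity) (by norm_num)).1 h1
    linarith
  calc ∑ x ∈ U, ‖∑ y ∈ I x, Ψ x y‖ ≤ ∑ x ∈ U, 2 * ∑ j ∈ Finset.range J, M x j :=
        Finset.sum_le_sum hpt
    _ = 2 * ∑ j ∈ Finset.range J, ∑ x ∈ U, M x j := by rw [← Finset.mul_sum, Finset.sum_comm]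
    _ ≤ 2 * ∑ j ∈ Finset.range J, (B * U.card * √L + 2 * √(U.card * L * W) * r ^ j) := by
        gcongr with j _; exact hlevel j
    _ = 2 * (J * (B * U.card * √L) + 2 * √(U.card * L * W) * ∑ j ∈ Finset.range J, r ^ j) := by
        rw [Finset.sum_add_distrib, Finset.sum_const, Finset.card_range, nsmul_eq_mul,
          ← Finset.mul_sum]
    _ ≤ 2 * (J * (B * U.card * √L) + 2 * √(U.card * L * W) * (12 * √√L)) := by gcongr
    _ = _ := by
        rw [Real.sqrt_mul (by positivity) (√(L : ℝ)), hJ]; push_cast; ring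

/-! ### The two bilinear estimates for a single frequency -/

/-- The integers of `(Y, 2Y]`. -/
noncomputable def dyadic (Y : ℝ) : Finset ℕ :=
  Finset.Ico (⌊Y⌋₊ + 1) (⌊Y⌋₊ + 1 + (⌊2 * Y⌋₊ - ⌊Y⌋₊))

lemma floor_le_floor_two_mul {Y : ℝ} (hY : 0 ≤ Y) : ⌊Y⌋₊ ≤ ⌊2 * Y⌋₊ :=
  Nat.floor_le_floor (by linarith)

lemma mem_dyadic {Y : ℝ} (hY : 0 ≤ Y) {n : ℕ} : n ∈ dyadic Y ↔ Y < n ∧ (n : ℝ) ≤ 2 * Y := by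
  have := floor_le_floor_two_mul hY
  rw [← Nat.floor_lt hY, ← Nat.le_floor_iff (by linarith), dyadic, Finset.mem_Ico]
  omega

lemma dyadic_length_le {Y : ℝ} (hY : 0 ≤ Y) : ((⌊2 * Y⌋₊ - ⌊Y⌋₊ : ℕ) : ℝ) ≤ 2 * Y :=
  le_trans (by exact_mod_cast Nat.sub_le _ _) (Nat.floor_le (by linarith : 0 ≤ 2 * Y))

lemma card_dyadic_le {Y : ℝ} (hY : 0 ≤ Y) : ((dyadic Y).card : ℝ) ≤ 2 * Y := by
  rw [dyadic, Nat.card_Ico, Nat.add_sub_cancel_left]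
  exact dyadic_length_le hY

lemma RunsOver.subset_dyadic {Y : ℝ} (hY : 0 ≤ Y) {S : Finset ℕ} (hS : RunsOver Y S) :
    S ⊆ dyadic Y := by
  obtain ⟨I, -, hI, hmem⟩ := hS
  intro n hn
  exact (mem_dyadic hY).2 (hI ((hmem n).1 hn))

lemma RunsOver.exists_eq_Ico {Y : ℝ} {S : Finset ℕ} (hS : RunsOver Y S) :
    ∃ s t, S = Finset.Ico s t := by
  obtain ⟨I, hI, -, hmem⟩ := hS
  refine exists_eq_Ico_of_convex S fun x hx z hz y hxy hyz => (hmem y).2 ?_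
  exact hI.out ((hmem x).1 hx) ((hmem z).1 hz) ⟨by exact_mod_cast hxy, by exact_mod_cast hyz⟩

lemma RunsOver.card_le {Y : ℝ} (hY : 0 ≤ Y) {S : Finset ℕ} (hS : RunsOver Y S) :
    (S.card : ℝ) ≤ 2 * Y :=
  le_trans (by exact_mod_cast Finset.card_le_card (hS.subset_dyadic hY)) (card_dyadic_le hY)

/-- The size conditions under which a smooth variable of size `N`, paired with a rough variable
of size `Y`, saves a factor `Z`. -/
structure Admissible (γ h N Y Z : ℝ) : Prop where
  one_le : 1 ≤ Z
  length : Z ^ 16 ≤ N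
  upper : h * (N * Y) ^ γ * Z ^ 28 ≤ N ^ 4
  lower : Z ^ 20 ≤ h * (N * Y) ^ γ

lemma Admissible.one_le_length {γ h N Y Z : ℝ} (H : Admissible γ h N Y Z) : 1 ≤ N :=
  (one_le_pow₀ H.one_le).trans H.length

/-- The correlation estimate with constant `C`, valid on every interval of the smooth variable. -/
def PairBound (γ C : ℝ) : Prop :=
  ∀ (α u h N Y Z : ℝ), 0 ≤ u → u ≤ 1 → 0 < h → 0 < Y → Admissible γ h N Y Z →
    ∀ S : Finset ℕ, (∃ s t, S = Finset.Ico s t) → S ⊆ dyadic N →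
    ∀ y ∈ dyadic Y, ∀ z ∈ dyadic Y, y < z →
      ‖∑ x ∈ S, e (phase γ α u h x y - phase γ α u h x z)‖ ≤
        C * (N / Z ^ 2 * √Y) / √((z : ℝ) - y)

lemma exists_pairBound {γ : ℝ} (hγ : 0 < γ) (hγ' : γ < 1) : ∃ C, 0 < C ∧ PairBound γ C := by
  obtain ⟨C, hC, hpair⟩ := pair_bound hγ hγ'
  refine ⟨C, hC, ?_⟩
  intro α u h N Y Z hu hu' hh hY H S hS hSN y hy z hz hyz
  have hN := H.one_le_length
  obtain ⟨s, t, rfl⟩ := hS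
  rcases le_or_gt t s with hst | hst
  · rw [Finset.Ico_eq_empty_of_le hst, Finset.sum_empty, norm_zero]
    positivity
  have h1 := (mem_dyadic (by linarith)).1 (hSN (Finset.left_mem_Ico.2 hst))
  have h2 := (mem_dyadic (by linarith)).1
    (hSN (Finset.mem_Ico.2 (⟨by omega, by omega⟩ : s ≤ t - 1 ∧ t - 1 < t)))
  rw [Nat.cast_sub (by omega : 1 ≤ t)] at h2
  push_cast at h2
  have hy' := (mem_dyadic hY.le).1 hy
  have hz' := (mem_dyadic hY.le).1 hz
  have hy0 : 1 ≤ y := Nat.one_le_iff_ne_zero.2 (by rintro rfl; simp at hy'; linarith)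
  exact hpair α u h N Y Z s t y z hu hu' hh hY H.one_le H.length H.upper H.lower h1.1.le
    (by linarith) hy'.1.le hz'.2 hy0 hyz

lemma norm_mul_e_mul_conj (a b : ℂ) {s t B : ℝ} (ha : ‖a‖ ≤ B) (hb : ‖b‖ ≤ B) :
    ‖a * (starRingEnd ℂ) b‖ ≤ B ^ 2 ∧
      a * e s * (starRingEnd ℂ) (b * e t) = a * (starRingEnd ℂ) b * e (s - t) := by
  constructor
  · rw [norm_mul, Complex.norm_conj, sq]
    exact mul_le_mul ha hb (norm_nonneg _) ((norm_nonneg _).trans ha)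
  · rw [map_mul, ← e_mul_conj]; ring

/-- Cauchy–Schwarz over k, with the dependence of its range on m placed in the summand as an
indicator. In a correlation the two indicators restrict k to an intersection of two intervals, where
`PairBound` applies. -/
theorem bilinear_smooth_inner {γ C A B : ℝ} (hC : 0 < C) (hpair : PairBound γ C) (hA : 0 < A)
    (hB : 0 < B) {α u h M K Z : ℝ} (hu : 0 ≤ u) (hu' : u ≤ 1) (hh : 0 < h)
    (H : Admissible γ h K M Z) (hM : Z ^ 2 ≤ M) (a b : ℕ → ℂ)
    (ha : ∀ m : ℕ, M < m → m ≤ 2 * M → ‖a m‖ ≤ A) (hb : ∀ k : ℕ, K < k → k ≤ 2 * K → ‖b k‖ ≤ B)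
    (ms : Finset ℕ) (ks : ℕ → Finset ℕ) (hms : RunsOver M ms) (hks : ∀ m ∈ ms, RunsOver K (ks m)) :
    ‖∑ m ∈ ms, ∑ k ∈ ks m, a m * b k * e (phase γ α u h m k)‖ ≤
      √(8 + 32 * C) * A * B * (M * K / Z) := by
  have hZ := H.one_le
  have hZ0 : 0 < Z := by linarith
  have hM1 : 1 ≤ M := (one_le_pow₀ hZ).trans hM
  have hM0 : 0 < M := by linarith
  have hK0 : 0 < K := by linarith [H.one_le_length]
  set Ψ : ℕ → ℕ → ℂ := fun k m => if k ∈ ks m then a m * e (phase γ α u h k m) else 0 with hΨ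
  have hsum : ∑ m ∈ ms, ∑ k ∈ ks m, a m * b k * e (phase γ α u h m k) =
      ∑ k ∈ dyadic K, b k * ∑ m ∈ ms, Ψ k m := by
    simp only [Finset.mul_sum]
    rw [Finset.sum_comm (s := dyadic K)]
    refine Finset.sum_congr rfl fun m hm => ?_
    rw [← Finset.sum_subset ((hks m hm).subset_dyadic hK0.le)]
    · refine Finset.sum_congr rfl fun k hk => ?_
      simp only [hΨ]
      rw [if_pos hk, phase_comm]; ring
    · intro k _ hk
      simp only [hΨ]
      rw [if_neg hk, mul_zero]
  have ha' : ∀ m ∈ ms, ‖a m‖ ≤ A := fun m hm => by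
    have := (mem_dyadic hM0.le).1 (hms.subset_dyadic hM0.le hm)
    exact ha m this.1 this.2
  have hbd := bilinear_bound (dyadic K) ms Ψ b (⌊M⌋₊ + 1) (⌊2 * M⌋₊ - ⌊M⌋₊) A B
    (A ^ 2 * (C * (K / Z ^ 2 * √M))) (by positivity) (hms.subset_dyadic hM0.le)
    (by
      intro k _ m hm
      simp only [hΨ]
      split_ifs
      · rw [norm_mul, norm_e, mul_one]; exact ha' m hm
      · rw [norm_zero]; exact hA.le)
    (fun k hk => by
      have := (mem_dyadic hK0.le).1 hk
      exact hb k this.1 this.2)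
    (by
      intro y hy z hz hyz
      have h1 : ∑ x ∈ dyadic K, Ψ x y * (starRingEnd ℂ) (Ψ x z) =
          a y * (starRingEnd ℂ) (a z) *
            ∑ x ∈ ks y ∩ ks z, e (phase γ α u h x y - phase γ α u h x z) := by
        rw [Finset.mul_sum, ← Finset.sum_subset
          (Finset.inter_subset_left.trans ((hks y hy).subset_dyadic hK0.le) : ks y ∩ ks z ⊆ _)]
        · refine Finset.sum_congr rfl fun x hx => ?_
          rw [Finset.mem_inter] at hx
          simp only [hΨ]
          rw [if_pos hx.1, if_pos hx.2, (norm_mul_e_mul_conj _ _ (ha' y hy) (ha' z hz)).2]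
        · intro x _ hx
          rw [Finset.mem_inter, not_and_or] at hx
          simp only [hΨ]
          rcases hx with hx | hx <;> simp [hx]
      rw [h1, norm_mul, mul_div_assoc]
      refine mul_le_mul (norm_mul_e_mul_conj _ _ (ha' y hy) (ha' z hz) (s := 0) (t := 0)).1 ?_
        (norm_nonneg _) (sq_nonneg _)
      refine hpair α u h K M Z hu hu' hh hM0 H _ ?_
        (Finset.inter_subset_left.trans ((hks y hy).subset_dyadic hK0.le)) y
        (hms.subset_dyadic hM0.le hy) z (hms.subset_dyadic hM0.le hz) hyz
      obtain ⟨s, t, hst⟩ := (hks y hy).exists_eq_Ico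
      obtain ⟨s', t', hst'⟩ := (hks z hz).exists_eq_Ico
      exact ⟨_, _, by rw [hst, hst', Finset.Ico_inter_Ico]⟩)
  rw [← hsum] at hbd
  refine le_of_sq_le_sq (hbd.trans ?_) (by positivity)
  have hU := card_dyadic_le hK0.le
  have hL := dyadic_length_le hM0.le
  have hsM : √M * √M = M := Real.mul_self_sqrt hM0.le
  have hsL : √((⌊2 * M⌋₊ - ⌊M⌋₊ : ℕ) : ℝ) ≤ 2 * √M := by
    rw [show 2 * √M = √(4 * M) by
      rw [Real.sqrt_mul (by norm_num), show (4 : ℝ) = 2 ^ 2 by norm_num]; simp]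
    exact Real.sqrt_le_sqrt (by linarith)
  have hMZ : 1 ≤ M / Z ^ 2 := by rw [le_div_iff₀ (by positivity)]; linarith
  calc _ ≤ 2 * K * (B ^ 2 * (2 * M * (A ^ 2 * (2 * K) +
        4 * (A ^ 2 * (C * (K / Z ^ 2 * √M))) * (2 * √M)))) := by gcongr
    _ = 4 * A ^ 2 * B ^ 2 * K ^ 2 * M * (2 * 1 + 8 * C * (√M * √M / Z ^ 2)) := by ring
    _ ≤ 4 * A ^ 2 * B ^ 2 * K ^ 2 * M * (2 * (M / Z ^ 2) + 8 * C * (M / Z ^ 2)) := by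
        rw [hsM]; gcongr
    _ = √(8 + 32 * C) ^ 2 * (A ^ 2 * B ^ 2 * (M * K / Z) ^ 2) := by
        rw [Real.sq_sqrt (by positivity)]; ring
    _ = _ := by ring

/-- An indicator for the range of k would destroy the smooth sum over m, so `maximal_bound` is used
instead; `hlog` pays for the logarithm on its diagonal. -/
theorem bilinear_smooth_outer {γ C A B : ℝ} (hC : 0 < C) (hpair : PairBound γ C) (hA : 0 < A)
    (hB : 0 < B) {α u h M K Z : ℝ} (hu : 0 ≤ u) (hu' : u ≤ 1) (hh : 0 < h)
    (H : Admissible γ h M K Z) (hK : 1 ≤ K) (hlog : Z * (Nat.log 2 ⌊2 * K⌋₊ + 1) ≤ √K)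
    (a b : ℕ → ℂ)
    (ha : ∀ m : ℕ, M < m → m ≤ 2 * M → ‖a m‖ ≤ A) (hb : ∀ k : ℕ, K < k → k ≤ 2 * K → ‖b k‖ ≤ B)
    (ms : Finset ℕ) (ks : ℕ → Finset ℕ) (hms : RunsOver M ms) (hks : ∀ m ∈ ms, RunsOver K (ks m)) :
    ‖∑ m ∈ ms, ∑ k ∈ ks m, a m * b k * e (phase γ α u h m k)‖ ≤
      (8 + 48 * √(8 * C)) * A * B * (M * K / Z) := by
  have hZ := H.one_le
  have hZ0 : 0 < Z := by linarith
  have hM0 : 0 < M := by linarith [H.one_le_length]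
  have hK0 : 0 < K := by linarith
  have ha' : ∀ m ∈ ms, ‖a m‖ ≤ A := fun m hm => by
    have := (mem_dyadic hM0.le).1 (hms.subset_dyadic hM0.le hm)
    exact ha m this.1 this.2
  have hb' : ∀ k ∈ dyadic K, ‖b k‖ ≤ B := fun k hk => by
    have := (mem_dyadic hK0.le).1 hk
    exact hb k this.1 this.2
  set Ψ : ℕ → ℕ → ℂ := fun m k => b k * e (phase γ α u h m k) with hΨ
  set L := ⌊2 * K⌋₊ - ⌊K⌋₊ with hLdef
  have hL1 : 1 ≤ L := by
    have h1 : 1 ≤ ⌊K⌋₊ := (Nat.one_le_floor_iff K).2 hK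
    have h2 : 2 * ⌊K⌋₊ ≤ ⌊2 * K⌋₊ := by
      refine Nat.le_floor ?_
      push_cast
      linarith [Nat.floor_le hK0.le]
    omega
  have hmax := maximal_bound ms Ψ (⌊K⌋₊ + 1) L B (B ^ 2 * (C * (M / Z ^ 2 * √K))) hL1 hB.le
    (by positivity)
    (by
      intro m _ k hk
      simp only [hΨ]
      rw [norm_mul, norm_e, mul_one]; exact hb' k hk)
    (by
      intro y hy z hz hyz
      have h1 : ∑ x ∈ ms, Ψ x y * (starRingEnd ℂ) (Ψ x z) =
          b y * (starRingEnd ℂ) (b z) *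
            ∑ x ∈ ms, e (phase γ α u h x y - phase γ α u h x z) := by
        rw [Finset.mul_sum]
        exact Finset.sum_congr rfl fun x _ => (norm_mul_e_mul_conj _ _ (hb' y hy) (hb' z hz)).2
      rw [h1, norm_mul, mul_div_assoc]
      exact mul_le_mul (norm_mul_e_mul_conj _ _ (hb' y hy) (hb' z hz) (s := 0) (t := 0)).1
        (hpair α u h M K Z hu hu' hh hK0 H ms hms.exists_eq_Ico (hms.subset_dyadic hM0.le) y hy z
          hz hyz) (norm_nonneg _) (sq_nonneg _))
    ks (fun m hm => (hks m hm).exists_eq_Ico) (fun m hm => (hks m hm).subset_dyadic hK0.le)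
  have h1 : ‖∑ m ∈ ms, ∑ k ∈ ks m, a m * b k * e (phase γ α u h m k)‖ ≤
      A * ∑ m ∈ ms, ‖∑ k ∈ ks m, Ψ m k‖ := by
    refine (norm_sum_le _ _).trans ?_
    rw [Finset.mul_sum]
    refine Finset.sum_le_sum fun m hm => ?_
    have : ∑ k ∈ ks m, a m * b k * e (phase γ α u h m k) = a m * ∑ k ∈ ks m, Ψ m k := by
      rw [Finset.mul_sum]
      exact Finset.sum_congr rfl fun k _ => mul_assoc _ _ _
    rw [this, norm_mul]
    exact mul_le_mul_of_nonneg_right (ha' m hm) (norm_nonneg _)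
  have hU := hms.card_le hM0.le
  have hL := dyadic_length_le hK0.le
  have hsK : √K * √K = K := Real.mul_self_sqrt hK0.le
  have hsL : √(L : ℝ) ≤ 2 * √K := by
    rw [show 2 * √K = √(4 * K) by
      rw [Real.sqrt_mul (by norm_num), show (4 : ℝ) = 2 ^ 2 by norm_num]; simp]
    exact Real.sqrt_le_sqrt (by linarith)
  have hlogL : (Nat.log 2 L + 1 : ℝ) ≤ √K / Z := by
    rw [le_div_iff₀ hZ0, mul_comm]
    refine le_trans ?_ hlog
    have : Nat.log 2 L ≤ Nat.log 2 ⌊2 * K⌋₊ := Nat.log_mono_right (Nat.sub_le _ _)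
    gcongr
  have hroot : √(ms.card * L * (B ^ 2 * (C * (M / Z ^ 2 * √K))) * √L) ≤
      √(8 * C) * (B * (M * K / Z)) := by
    rw [← Real.sqrt_sq (by positivity : 0 ≤ B * (M * K / Z)), ← Real.sqrt_mul (by positivity)]
    apply Real.sqrt_le_sqrt
    calc _ ≤ 2 * M * (2 * K) * (B ^ 2 * (C * (M / Z ^ 2 * √K))) * (2 * √K) := by gcongr
      _ = 8 * C * (B ^ 2 * (M ^ 2 * K * (√K * √K) / Z ^ 2)) := by ring
      _ = _ := by rw [hsK]; ring
  refine h1.trans ?_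
  calc A * ∑ m ∈ ms, ‖∑ k ∈ ks m, Ψ m k‖
      ≤ A * (2 * (√K / Z) * (B * (2 * M) * (2 * √K)) + 48 * (√(8 * C) * (B * (M * K / Z)))) := by
        refine mul_le_mul_of_nonneg_left (hmax.trans ?_) hA.le
        gcongr
    _ = A * (8 * B * M * (√K * √K) / Z + 48 * (√(8 * C) * (B * (M * K / Z)))) := by ring
    _ = _ := by rw [hsK]; ring

/-! ### The proposition -/

lemma natLog_le_rpow {X : ℝ} (hX : 1 ≤ X) {n : ℕ} (hn : (n : ℝ) ≤ X ^ (2 : ℝ)) :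
    (Nat.log 2 n + 1 : ℝ) ≤ 4000 * X ^ (1 / 1000 : ℝ) := by
  have h1 : 1 ≤ X ^ (1 / 1000 : ℝ) := Real.one_le_rpow hX (by norm_num)
  rcases Nat.eq_zero_or_pos n with rfl | hn0
  · simp; linarith
  have hn0' : (0 : ℝ) < n := by exact_mod_cast hn0
  have h2 : (2 : ℝ) ^ Nat.log 2 n ≤ n := by exact_mod_cast Nat.pow_log_le_self 2 hn0.ne'
  have h3 : (Nat.log 2 n : ℝ) * Real.log 2 ≤ 2 * Real.log X := by
    rw [← Real.log_pow, ← Real.log_rpow (by linarith)]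
    exact Real.log_le_log (by positivity) (h2.trans hn)
  have h4 := Real.log_le_rpow_div (by linarith : 0 ≤ X) (by norm_num : (0 : ℝ) < 1 / 1000)
  have h5 := Real.log_two_gt_d9
  have h6 : (0 : ℝ) ≤ Nat.log 2 n := Nat.cast_nonneg _
  have h7 : X ^ (1 / 1000 : ℝ) / (1 / 1000) = 1000 * X ^ (1 / 1000 : ℝ) := by ring
  rw [h7] at h4
  nlinarith

/-- Once X is large, writing every quantity as a power of X turns the size conditions into linear
inequalities between exponents. The slack 1/1000 absorbs c₁, c₂, the factor 2 and the logarithm. -/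
lemma bilinear_large {γ C A B c₁ c₂ E : ℝ} (hγ' : γ < 1)
    (hC : 0 < C) (hpair : PairBound γ C) (hA : 0 < A) (hB : 0 < B) (hc₁ : 0 < c₁)
    (hδE : 1 - γ < E) (hE : E ≤ 1 / 24) {X M K α u h : ℝ}
    (hX : (4000 + c₂ + 1 / c₁) ≤ X ^ (1 / 1000 : ℝ)) (hX1 : 1 ≤ X) (hc₂ : 0 < c₂)
    (hMK : c₁ * X ≤ M * K) (hMK' : M * K ≤ c₂ * X) (hM : X ^ (16 * E) ≤ M)
    (hM' : M ≤ X ^ (16 / 17 + 16 / 17 * (1 - γ) - 32 / 17 * E))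
    (hu : 0 ≤ u) (hu' : u ≤ 1) (hh : 1 ≤ h) (hhE : h ≤ 2 * X ^ E) (a b : ℕ → ℂ)
    (ha : ∀ m : ℕ, M < m → m ≤ 2 * M → ‖a m‖ ≤ A) (hb : ∀ k : ℕ, K < k → k ≤ 2 * K → ‖b k‖ ≤ B)
    (ms : Finset ℕ) (ks : ℕ → Finset ℕ) (hms : RunsOver M ms) (hks : ∀ m ∈ ms, RunsOver K (ks m)) :
    ‖∑ m ∈ ms, ∑ k ∈ ks m, a m * b k * e (phase γ α u h m k)‖ ≤
      max (√(8 + 32 * C)) (8 + 48 * √(8 * C)) * A * B * (M * K / X ^ E) := by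
  have hX0 : 0 < X := by linarith
  have hc₁' : 0 < 1 / c₁ := by positivity
  have hXne : 1 < X := by
    by_contra hle
    have : X = 1 := by linarith
    rw [this, Real.one_rpow] at hX
    linarith
  have mono : ∀ {s t : ℝ}, s ≤ t → X ^ s ≤ X ^ t := fun h => Real.rpow_le_rpow_of_exponent_le hX1 h
  have hM0 : 0 < M := (Real.rpow_pos_of_pos hX0 _).trans_le hM
  have hMK0 : 0 < M * K := (mul_pos hc₁ hX0).trans_le hMK
  have hK0 : 0 < K := pos_of_mul_pos_right hMK0 hM0.le
  have hh0 : 0 < h := by linarith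
  have hF0 : 0 < h * (M * K) ^ γ := by positivity
  have repr : ∀ {Y : ℝ}, 0 < Y → ∃ y : ℝ, Y = X ^ y := fun {Y} hY =>
    ⟨Real.logb X Y, (Real.rpow_logb hX0 hXne.ne' hY).symm⟩
  have le_iff : ∀ {s t : ℝ}, X ^ s ≤ X ^ t ↔ s ≤ t := Real.rpow_le_rpow_left_iff hXne
  obtain ⟨μ, rfl⟩ := repr hM0
  obtain ⟨κ, rfl⟩ := repr hK0
  obtain ⟨f, hf⟩ := repr hF0
  have hpow : ∀ (s : ℝ) (n : ℕ), (X ^ s) ^ n = X ^ (n * s) := fun s n => by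
    rw [mul_comm, Real.rpow_mul_natCast hX0.le]
  rw [le_iff] at hM hM'
  have hMKX : X ^ μ * X ^ κ = X ^ (μ + κ) := (Real.rpow_add hX0 _ _).symm
  have hlow : 1 - 1 / 1000 ≤ μ + κ := by
    rw [← le_iff, ← hMKX]
    refine le_trans ?_ hMK
    rw [Real.rpow_sub hX0, Real.rpow_one, div_le_iff₀ (by positivity)]
    have : 1 / c₁ ≤ X ^ (1 / 1000 : ℝ) := by linarith
    calc X = c₁ * X * (1 / c₁) := by field_simp
      _ ≤ _ := by gcongr
  have hupp : μ + κ ≤ 1 + 1 / 1000 := by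
    rw [← le_iff, ← hMKX]
    refine hMK'.trans ?_
    rw [Real.rpow_add hX0, Real.rpow_one, mul_comm]
    gcongr
    linarith
  have hfeq : X ^ f = h * X ^ ((μ + κ) * γ) := by rw [← hf, hMKX, Real.rpow_mul hX0.le]
  have hflow : (μ + κ) * γ ≤ f := by
    rw [← le_iff, hfeq]
    exact le_mul_of_one_le_left (by positivity) hh
  have hfupp : f ≤ E + 1 / 1000 + (μ + κ) * γ := by
    rw [← le_iff, hfeq, Real.rpow_add hX0, Real.rpow_add hX0]
    have : 2 ≤ X ^ (1 / 1000 : ℝ) := by linarith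
    refine mul_le_mul_of_nonneg_right (hhE.trans ?_) (by positivity)
    rw [mul_comm]
    gcongr
  have hflow' : 23 / 24 - 1 / 1000 ≤ f := by nlinarith
  have hfupp' : f ≤ E + 1 - (1 - γ) + 2 / 1000 := by nlinarith
  have hE0 : 0 < E := by linarith
  have hZ1 : 1 ≤ X ^ E := Real.one_le_rpow hX1 hE0.le
  have hlower : (X ^ E) ^ 20 ≤ h * (X ^ μ * X ^ κ) ^ γ := by
    rw [hf, hpow, le_iff]; push_cast; linarith
  -- Decides which variable is smooth. In the second case 16E ≤ μ and 4μ < f + 28E force E < 0.03,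
  -- which gives K all the room that it needs.
  rcases le_or_gt (f + 28 * E) (4 * μ) with hcase | hcase
  · have H : Admissible γ h (X ^ μ) (X ^ κ) (X ^ E) := by
      refine ⟨hZ1, ?_, ?_, hlower⟩
      · rw [hpow, le_iff]; push_cast; exact hM
      · rw [hf, hpow, hpow, ← Real.rpow_add hX0, le_iff]; push_cast; exact hcase
    have hκ : 1 / 17 - 1 / 1000 + 32 / 17 * E - 16 / 17 * (1 - γ) ≤ κ := by linarith
    have hK1 : 1 ≤ X ^ κ := Real.one_le_rpow hX1 (by linarith)
    refine (bilinear_smooth_outer hC hpair hA hB hu hu' hh0 H hK1 ?_ a b ha hb ms ks hms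
      hks).trans ?_
    · have h2K : ((⌊2 * X ^ κ⌋₊ : ℕ) : ℝ) ≤ X ^ (2 : ℝ) := by
        refine (Nat.floor_le (by positivity)).trans ?_
        calc 2 * X ^ κ ≤ X ^ (1 / 1000 : ℝ) * X ^ κ := by gcongr; linarith
          _ = X ^ (1 / 1000 + κ) := (Real.rpow_add hX0 _ _).symm
          _ ≤ _ := mono (by linarith)
      calc X ^ E * (Nat.log 2 ⌊2 * X ^ κ⌋₊ + 1)
          ≤ X ^ E * (4000 * X ^ (1 / 1000 : ℝ)) := by
            gcongr; exact natLog_le_rpow hX1 h2K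
        _ ≤ X ^ E * (X ^ (1 / 1000 : ℝ) * X ^ (1 / 1000 : ℝ)) := by gcongr; linarith
        _ = X ^ (E + (1 / 1000 + 1 / 1000)) := by rw [Real.rpow_add hX0, Real.rpow_add hX0]
        _ ≤ X ^ (κ * (1 / 2)) := mono (by linarith)
        _ = √(X ^ κ) := by rw [Real.sqrt_eq_rpow, Real.rpow_mul hX0.le]
    · gcongr
      exact le_max_right _ _
  · have H : Admissible γ h (X ^ κ) (X ^ μ) (X ^ E) := by
      refine ⟨hZ1, ?_, ?_, by rw [mul_comm (X ^ κ)]; exact hlower⟩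
      · rw [hpow, le_iff]; push_cast; linarith
      · rw [mul_comm (X ^ κ), hf, hpow, hpow, ← Real.rpow_add hX0, le_iff]; push_cast; linarith
    refine (bilinear_smooth_inner hC hpair hA hB hu hu' hh0 H ?_ a b ha hb ms ks hms hks).trans ?_
    · rw [hpow, le_iff]; push_cast; linarith
    · gcongr
      exact le_max_left _ _

lemma bilinear_trivial {A B : ℝ} (hA : 0 ≤ A) (hB : 0 ≤ B) {M K : ℝ} (hM : 0 ≤ M) (hK : 0 ≤ K)
    (φ : ℕ → ℕ → ℝ) (a b : ℕ → ℂ)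
    (ha : ∀ m : ℕ, M < m → m ≤ 2 * M → ‖a m‖ ≤ A) (hb : ∀ k : ℕ, K < k → k ≤ 2 * K → ‖b k‖ ≤ B)
    (ms : Finset ℕ) (ks : ℕ → Finset ℕ) (hms : RunsOver M ms) (hks : ∀ m ∈ ms, RunsOver K (ks m)) :
    ‖∑ m ∈ ms, ∑ k ∈ ks m, a m * b k * e (φ m k)‖ ≤ 4 * A * B * (M * K) := by
  have h1 : ∀ m ∈ ms, ‖∑ k ∈ ks m, a m * b k * e (φ m k)‖ ≤ 2 * K * (A * B) := by
    intro m hm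
    have hm' := (mem_dyadic hM).1 (hms.subset_dyadic hM hm)
    have h2 : ∀ k ∈ ks m, ‖a m * b k * e (φ m k)‖ ≤ A * B := by
      intro k hk
      have hk' := (mem_dyadic hK).1 ((hks m hm).subset_dyadic hK hk)
      rw [norm_mul, norm_mul, norm_e, mul_one]
      exact mul_le_mul (ha m hm'.1 hm'.2) (hb k hk'.1 hk'.2) (norm_nonneg _) hA
    refine (norm_sum_le _ _).trans ((Finset.sum_le_sum h2).trans ?_)
    rw [Finset.sum_const, nsmul_eq_mul]
    exact mul_le_mul_of_nonneg_right ((hks m hm).card_le hK) (mul_nonneg hA hB)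
  refine (norm_sum_le _ _).trans ((Finset.sum_le_sum h1).trans ?_)
  rw [Finset.sum_const, nsmul_eq_mul]
  calc (ms.card : ℝ) * (2 * K * (A * B)) ≤ 2 * M * (2 * K * (A * B)) := by
        gcongr; exact hms.card_le hM
    _ = _ := by ring

theorem bilinear_saving {γ A B c₁ c₂ E : ℝ} (hγ : 0 < γ) (hγ' : γ < 1) (hA : 0 < A) (hB : 0 < B)
    (hc₁ : 0 < c₁) (hc₂ : 0 < c₂) (hδE : 1 - γ < E) :
    ∃ C : ℝ, 0 < C ∧ ∀ X M K α u h : ℝ, 1 ≤ X → c₁ * X ≤ M * K → M * K ≤ c₂ * X →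
      X ^ (16 * E) ≤ M → M ≤ X ^ (16 / 17 + 16 / 17 * (1 - γ) - 32 / 17 * E) →
      M ≤ X ^ (2 - 32 * E) → 0 ≤ u → u ≤ 1 → 1 ≤ h → h ≤ 2 * X ^ E → ∀ a b : ℕ → ℂ,
      (∀ m : ℕ, M < m → m ≤ 2 * M → ‖a m‖ ≤ A) → (∀ k : ℕ, K < k → k ≤ 2 * K → ‖b k‖ ≤ B) →
      ∀ (ms : Finset ℕ) (ks : ℕ → Finset ℕ), RunsOver M ms → (∀ m ∈ ms, RunsOver K (ks m)) →
      ‖∑ m ∈ ms, ∑ k ∈ ks m, a m * b k * e (phase γ α u h m k)‖ ≤ C * (X / X ^ E) := by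
  obtain ⟨C, hC, hpair⟩ := exists_pairBound hγ hγ'
  have hE0 : 0 < E := by linarith
  obtain ⟨K₀, hK₀⟩ : ∃ K₀, K₀ = 4000 + c₂ + 1 / c₁ := ⟨_, rfl⟩
  have hK₀1 : 1 ≤ K₀ := by
    have : 0 < 1 / c₁ := by positivity
    linarith
  obtain ⟨X₀, hX₀1, hX₀⟩ : ∃ X₀ : ℝ, 1 ≤ X₀ ∧ ∀ X, X₀ < X → K₀ ≤ X ^ (1 / 1000 : ℝ) := by
    obtain ⟨X₀, h⟩ := Filter.eventually_atTop.1
      ((tendsto_rpow_atTop (by norm_num : (0 : ℝ) < 1 / 1000)).eventually_ge_atTop K₀)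
    exact ⟨max 1 X₀, le_max_left _ _, fun X hX => h X ((le_max_right _ _).trans hX.le)⟩
  have hX₀0 : 0 < X₀ := by linarith
  obtain ⟨C₁, hC₁⟩ : ∃ C₁, C₁ = max (√(8 + 32 * C)) (8 + 48 * √(8 * C)) := ⟨_, rfl⟩
  have hC₁0 : 0 < C₁ := hC₁ ▸ lt_max_of_lt_right (by positivity)
  refine ⟨C₁ * A * B * c₂ + 4 * A * B * c₂ * X₀ ^ E, by positivity, ?_⟩
  intro X M K α u h hX hMK hMK' hM hM' hM'' hu hu' hh hhE a b ha hb ms ks hms hks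
  have hX0 : 0 < X := by linarith
  have hM0 : 0 < M := (Real.rpow_pos_of_pos hX0 _).trans_le hM
  have hMK0 : 0 < M * K := (mul_pos hc₁ hX0).trans_le hMK
  have hK0 : 0 < K := pos_of_mul_pos_right hMK0 hM0.le
  have hXE : 0 < X ^ E := Real.rpow_pos_of_pos hX0 _
  have hX₀E : 0 < X₀ ^ E := Real.rpow_pos_of_pos hX₀0 _
  rcases le_or_gt X X₀ with hle | hlt
  · refine (bilinear_trivial hA.le hB.le hM0.le hK0.le (fun m k => phase γ α u h m k) a b ha hb ms
      ks hms hks).trans ?_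
    have h1 : X ^ E ≤ X₀ ^ E := Real.rpow_le_rpow hX0.le hle hE0.le
    have h2 : 0 ≤ C₁ * A * B * c₂ * (X / X ^ E) := by positivity
    calc 4 * A * B * (M * K) ≤ 4 * A * B * (c₂ * X) := by gcongr
      _ = 4 * A * B * c₂ * X ^ E * (X / X ^ E) := by field_simp
      _ ≤ 4 * A * B * c₂ * X₀ ^ E * (X / X ^ E) := by gcongr
      _ ≤ _ := by rw [add_mul]; linarith
  -- X^{16E} ≤ M ≤ X^{2-32E} with X > 1 gives 48E ≤ 2.
  · have hE : E ≤ 1 / 24 := by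
      have := (Real.rpow_le_rpow_left_iff (hX₀1.trans_lt hlt)).1 (hM.trans hM'')
      linarith
    have hXK := hX₀ X hlt
    rw [hK₀] at hXK
    refine (bilinear_large hγ' hC hpair hA hB hc₁ hδE hE hXK hX hc₂ hMK hMK' hM hM' hu hu' hh
      hhE a b ha hb ms ks hms hks).trans ?_
    have h2 : 0 ≤ 4 * A * B * c₂ * X₀ ^ E * (X / X ^ E) := by positivity
    rw [← hC₁]
    calc C₁ * A * B * (M * K / X ^ E) ≤ C₁ * A * B * (c₂ * X / X ^ E) := by gcongr
      _ = C₁ * A * B * c₂ * (X / X ^ E) := by ring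
      _ ≤ _ := by rw [add_mul]; linarith

end TypeII

theorem proposition4p2
    (γ Δ ε : ℝ) (hγ : 1 / 2 < γ) (hγ' : γ < 1) (hΔ : 0 ≤ Δ) (hΔ' : Δ < 1 / 2) (hε : 0 < ε)
    (c₁ c₂ A B : ℝ) (hc₁ : 0 < c₁) (hc₂ : 0 < c₂) (hA : 0 < A) (hB : 0 < B) :
    ∃ C : ℝ, 0 < C ∧
      ∀ X M K H α u : ℝ, 1 ≤ X →
        c₁ * X ≤ M * K → M * K ≤ c₂ * X →
        X ^ TypeII.bExp γ Δ ε ≤ M → M ≤ X ^ TypeII.cExp γ Δ ε →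
        0 < H → H ≤ TypeII.H₀ γ Δ ε X →
        0 ≤ u → u ≤ 1 →
        ∀ a b : ℕ → ℂ,
          (∀ m : ℕ, M < m → m ≤ 2 * M → ‖a m‖ ≤ A) →
          (∀ k : ℕ, K < k → k ≤ 2 * K → ‖b k‖ ≤ B) →
          ∀ (hs : Finset ℕ) (ms : ℕ → Finset ℕ) (ks : ℕ → ℕ → Finset ℕ),
            TypeII.RunsOver H hs →
            (∀ h ∈ hs, TypeII.RunsOver M (ms h)) →
            (∀ h ∈ hs, ∀ m ∈ ms h, TypeII.RunsOver K (ks h m)) →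
            TypeII.SII γ X H α u a b hs ms ks ≤ C * X ^ (1 - Δ - 7 * ε) := by
  obtain ⟨C, hC, hsave⟩ := TypeII.bilinear_saving (γ := γ) (E := 1 - γ + Δ + 7 * ε) (by linarith)
    hγ' hA hB hc₁ hc₂ (by linarith)
  refine ⟨2 * C, by positivity, ?_⟩
  intro X M K H α u hX hMK hMK' hM hM' hH hH' hu hu' a b ha hb hs ms ks hhs hms hks
  have hX0 : 0 < X := by linarith
  have hterm : ∀ h ∈ hs, ‖∑ m ∈ ms h, ∑ k ∈ ks h m, a m * b k *
      TypeII.e ((m : ℝ) ^ 3 * (k : ℝ) ^ 3 * α + (h : ℝ) * ((m : ℝ) * (k : ℝ) + u) ^ γ)‖ ≤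
        C * (X / X ^ (1 - γ + Δ + 7 * ε)) := by
    intro h hh
    have hmem := (TypeII.mem_dyadic hH.le).1 (hhs.subset_dyadic hH.le hh)
    have h1 : (1 : ℝ) ≤ h := by
      have : 0 < h := by exact_mod_cast hH.trans hmem.1
      exact_mod_cast this
    refine hsave X M K α u h hX hMK hMK' ?_ ?_ ?_ hu hu' h1 ?_ a b ha hb _ _ (hms h hh) (hks h hh)
    · refine le_of_eq_of_le ?_ hM
      rw [TypeII.bExp]; congr 1; ring
    · refine hM'.trans (Real.rpow_le_rpow_of_exponent_le hX ((min_le_left _ _).trans_eq ?_))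
      ring
    · refine hM'.trans (Real.rpow_le_rpow_of_exponent_le hX ((min_le_right _ _).trans_eq ?_))
      ring
    · rw [TypeII.H₀] at hH'
      linarith [hmem.2]
  rw [TypeII.SII]
  have hcard := hhs.card_le hH.le
  have hH₁ : 0 < TypeII.H₁ γ X := Real.rpow_pos_of_pos hX0 _
  have hZ : 0 < X ^ (1 - γ + Δ + 7 * ε) := Real.rpow_pos_of_pos hX0 _
  -- The entry H₁/H of the minimum cancels the number of frequencies for every H, small or large.
  calc _ ≤ TypeII.H₁ γ X / H * (2 * H * (C * (X / X ^ (1 - γ + Δ + 7 * ε)))) := by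
        refine mul_le_mul (min_le_right _ _) ?_ (Finset.sum_nonneg fun _ _ => norm_nonneg _)
          (by positivity)
        refine (Finset.sum_le_sum hterm).trans ?_
        rw [Finset.sum_const, nsmul_eq_mul]
        gcongr
    _ = 2 * C * (TypeII.H₁ γ X * (X / X ^ (1 - γ + Δ + 7 * ε))) := by field_simp
    _ = _ := by
        have h1 : X / X ^ (1 - γ + Δ + 7 * ε) = X ^ (1 - (1 - γ + Δ + 7 * ε)) := by
          rw [Real.rpow_sub hX0, Real.rpow_one]
        rw [TypeII.H₁, h1, ← Real.rpow_add hX0]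
        congr 2; ring
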